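/- **Lemma (Splitting lemma).** Let $N\ge 3$, $2^*:=\frac{2N}{N-2}$, and let $D^{1,2}(\mathbb R^N)=\{u\in L^{2^*}(\mathbb R^N):\nabla u\in L^2(\mathbb R^N,\mathbb R^N)\}$ with norm $\|u\|=(\int_{\mathbb R^N}|\nabla u|^2)^{1/2}$, where $\nabla u$ is the weak gradient. Assume the following. - $V\in L^{N/2}(\mathbb R^N)\cap L^r(\mathbb R^N)$ for some $r>N/2$, and $\int_{\mathbb R^N}|V^-|^{N/2}<S^{N/2}$, where $V^-:=\min\{0,V\}$ and $S$ is the best constant of the embedding $D^{1,2}(\mathbb R^N)\hookrightarrow L^{2^*}(\mathbb R^N)$, i.e. $S=\inf_{u\neq 0}\|u\|^2/|u|_{2^*}^2$. - $f\in\mathcal C^1(\mathbb R)$ is odd and, with $F(s):=\int_0^s f(t)\,\mathrm dt$, there are constants $A_1>0$ and $2<p<2^*<q$ such that $|F(s)|\le A_1|s|^{p}$, $|f(s)|\le A_1|s|^{p-1}$, $|f'(s)|\le A_1|s|^{p-2}$ if $|s|\ge 1$, and $|F(s)|\le A_1|s|^{q}$, $|f(s)|\le A_1|s|^{q-1}$,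 $|f'(s)|\le A_1|s|^{q-2}$ if $|s|\le 1$. - There is a constant $\theta>2$ such that $0\le\theta F(s)\le f(s)s<f'(s)s^2$ for all $s>0$. For $u,v\in D^{1,2}(\mathbb R^N)$ set $$\langle u,v\rangle_V:=\int_{\mathbb R^N}(\nabla u\cdot\nabla v+Vuv),\qquad \|u\|_V^2:=\langle u,u\rangle_V,\qquad I_V(u):=\tfrac12\|u\|_V^2-\int_{\mathbb R^N}F(u),$$ and let $\nabla I_V(u)\in D^{1,2}(\mathbb R^N)$ be the gradient of $I_V$ at $u$ with respect to $\langle\cdot,\cdot\rangle_V$; $I_0$ denotes $I_V$ for $V=0$. A solution of $$-\Delta u+Vu=f(u),\qquad u\in D^{1,2}(\mathbb R^N),\tag{$\wp_V$}$$ is a weak solution: $\langle u,v\rangle_V=\int_{\mathbb R^N} f(u)v$ for all $v\in D^{1,2}(\mathbb R^N)$. The limit problem $(\wp_0)$ is the case $V=0$. Let $d\in\mathbb R$ and let $(u_k)$ be a bounded sequence in $D^{1,2}(\mathbb R^N)$ such that $I_V(u_k)\to d$ and $\|\nabla I_V(u_k)\|_V\to 0$. Then, after replacing $(u_k)$ by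 a subsequence, there exist a solution $u$ of $(\wp_V)$, a number $m\in\mathbb N\cup\{0\}$, $m$ nontrivial solutions $w_1,\dots,w_m$ of the limit problem $(\wp_0)$, and $m$ sequences of points $(y_{j,k})_k$ in $\mathbb R^N$, $1\le j\le m$, such that 1. $|y_{j,k}|\to\infty$ for every $j$, and $|y_{j,k}-y_{i,k}|\to\infty$ if $i\ne j$; 2. $u_k-\sum_{i=1}^m w_i(\cdot-y_{i,k})\to u$ in $D^{1,2}(\mathbb R^N)$; 3. $d=I_V(u)+\sum_{i=1}^m I_0(w_i)$. -/

import Mathlib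

open MeasureTheory Filter Topology
open scoped ContDiff ENNReal

noncomputable section

namespace ZeroMass

/-- The Euclidean space `ℝ^N`, with its Lebesgue measure `volume`. -/
abbrev RN (N : ℕ) : Type := EuclideanSpace ℝ (Fin N)

/-- The critical Sobolev exponent `2* = 2N / (N - 2)` (used for `N ≥ 3` only). -/
def twoStar (N : ℕ) : ℝ := 2 * (N : ℝ) / ((N : ℝ) - 2)

/-- `g` is the weak gradient of `u`: both are locally integrable and
`∫ u ∂_e φ = - ∫ φ ⟨g, e⟩` for every test function `φ ∈ C_c^∞(ℝ^N)` and every direction `e`. -/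
def IsWeakGradient {N : ℕ} (u : RN N → ℝ) (g : RN N → RN N) : Prop :=
  LocallyIntegrable u volume ∧ LocallyIntegrable g volume ∧
    ∀ φ : RN N → ℝ, ContDiff ℝ ∞ φ → HasCompactSupport φ → ∀ e : RN N,
      ∫ x, u x * fderiv ℝ φ x e = - ∫ x, φ x * inner ℝ (g x) e

/-- Membership in `D^{1,2}(ℝ^N) = {u ∈ L^{2*}(ℝ^N) : ∇u ∈ L²(ℝ^N, ℝ^N)}`. Elements are represented
by functions; functions that agree almost everywhere represent the same element. -/
def MemD12 {N : ℕ} (u : RN N → ℝ) : Prop :=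
  MemLp u (ENNReal.ofReal (twoStar N)) volume ∧
    ∃ g : RN N → RN N, MemLp g 2 volume ∧ IsWeakGradient u g

open Classical in
/-- The weak gradient `∇u` of `u` (a representative; it is unique almost everywhere). The value is
`0` if `u` has no weak gradient in `L²`. -/
def weakGrad {N : ℕ} (u : RN N → ℝ) : RN N → RN N :=
  if h : ∃ g : RN N → RN N, MemLp g 2 volume ∧ IsWeakGradient u g then h.choose else 0

/-- The standard norm `‖u‖ = (∫ |∇u|²)^{1/2}` of `D^{1,2}(ℝ^N)`. -/
def normD {N : ℕ} (u : RN N → ℝ) : ℝ :=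
  Real.sqrt (∫ x, ‖weakGrad u x‖ ^ 2)

/-- `⟨u, v⟩_V = ∫ (∇u · ∇v + V u v)`. -/
def innerV {N : ℕ} (V : RN N → ℝ) (u v : RN N → ℝ) : ℝ :=
  ∫ x, (inner ℝ (weakGrad u x) (weakGrad v x) + V x * u x * v x)

/-- `‖u‖_V = (∫ (|∇u|² + V u²))^{1/2}`. -/
def normV {N : ℕ} (V : RN N → ℝ) (u : RN N → ℝ) : ℝ :=
  Real.sqrt (∫ x, (‖weakGrad u x‖ ^ 2 + V x * u x ^ 2))

/-- The best constant `S` of the embedding `D^{1,2}(ℝ^N) ↪ L^{2*}(ℝ^N)`, that is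
`S = inf {‖u‖² / |u|²_{2*} : u ∈ D^{1,2}(ℝ^N), u ≠ 0}`. -/
def sobolevConst (N : ℕ) : ℝ :=
  sInf {t : ℝ | ∃ u : RN N → ℝ, MemD12 u ∧ ¬ (u =ᵐ[volume] 0) ∧
    t = normD u ^ 2 / (eLpNorm u (ENNReal.ofReal (twoStar N)) volume).toReal ^ 2}

/-- The assumption on the potential: `V ∈ L^{N/2} ∩ L^r` for some `r > N/2`, and
`∫ |V⁻|^{N/2} < S^{N/2}` with `V⁻ = min {0, V}`. -/
structure PotentialAssumption {N : ℕ} (V : RN N → ℝ) : Prop where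
  memLp_half : MemLp V (ENNReal.ofReal ((N : ℝ) / 2)) volume
  memLp_more : ∃ r : ℝ≥0∞, ENNReal.ofReal ((N : ℝ) / 2) < r ∧ MemLp V r volume
  neg_part_small :
    ∫ x, |min 0 (V x)| ^ ((N : ℝ) / 2) < sobolevConst N ^ ((N : ℝ) / 2)

/-- The primitive `F(s) = ∫_0^s f(t) dt`. -/
def primitive (f : ℝ → ℝ) (s : ℝ) : ℝ := ∫ t in (0 : ℝ)..s, f t

/-- Regularity, symmetry and growth of the nonlinearity: `f` is the odd extension to `ℝ` of a `C¹`
function on `[0, ∞)`, and there are `A₁ > 0` and `2 < p < 2* < q` such that `F`, `f`, `f'` are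
bounded by `A₁ |s|^p`, `A₁ |s|^{p-1}`, `A₁ |s|^{p-2}` for `|s| ≥ 1` and by
`A₁ |s|^q`, `A₁ |s|^{q-1}`, `A₁ |s|^{q-2}` for `|s| ≤ 1`. -/
structure GrowthAssumption (N : ℕ) (f : ℝ → ℝ) : Prop where
  contDiff : ContDiff ℝ 1 f
  odd : ∀ s : ℝ, f (-s) = - f s
  growth : ∃ A₁ p q : ℝ, 0 < A₁ ∧ 2 < p ∧ p < twoStar N ∧ twoStar N < q ∧
    (∀ s : ℝ, 1 ≤ |s| →
      |primitive f s| ≤ A₁ * |s| ^ p ∧ |f s| ≤ A₁ * |s| ^ (p - 1) ∧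
        |deriv f s| ≤ A₁ * |s| ^ (p - 2)) ∧
    (∀ s : ℝ, |s| ≤ 1 →
      |primitive f s| ≤ A₁ * |s| ^ q ∧ |f s| ≤ A₁ * |s| ^ (q - 1) ∧
        |deriv f s| ≤ A₁ * |s| ^ (q - 2))

/-- There is `θ > 2` such that `0 ≤ θ F(s) ≤ f(s) s < f'(s) s²` for all `s > 0`. -/
def SuperlinearAssumption (f : ℝ → ℝ) : Prop :=
  ∃ θ : ℝ, 2 < θ ∧ ∀ s : ℝ, 0 < s →
    0 ≤ θ * primitive f s ∧ θ * primitive f s ≤ f s * s ∧ f s * s < deriv f s * s ^ 2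

/-- The energy `I_V(u) = ½ ∫ (|∇u|² + V u²) - ∫ F(u)`. -/
def energy {N : ℕ} (V : RN N → ℝ) (f : ℝ → ℝ) (u : RN N → ℝ) : ℝ :=
  (1 / 2) * (∫ x, (‖weakGrad u x‖ ^ 2 + V x * u x ^ 2)) - ∫ x, primitive f (u x)

/-- `u` is a (weak) solution of `-Δu + V u = f(u)`, `u ∈ D^{1,2}(ℝ^N)`:
`∫ (∇u · ∇v + V u v) = ∫ f(u) v` for every `v ∈ D^{1,2}(ℝ^N)`. -/
def IsSolution {N : ℕ} (V : RN N → ℝ) (f : ℝ → ℝ) (u : RN N → ℝ) : Prop :=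
  MemD12 u ∧ ∀ v : RN N → ℝ, MemD12 v → innerV V u v = ∫ x, f (u x) * v x

/-- `g = ∇I_V(u)`: `g ∈ D^{1,2}(ℝ^N)` is the gradient of `I_V` at `u` with respect to the scalar
product `⟨·, ·⟩_V`, that is `I_V(u + v) = I_V(u) + ⟨g, v⟩_V + o(‖v‖)` as `v → 0` in
`D^{1,2}(ℝ^N)`. -/
def IsEnergyGradient {N : ℕ} (V : RN N → ℝ) (f : ℝ → ℝ) (u g : RN N → ℝ) : Prop :=
  MemD12 g ∧ ∀ ε : ℝ, 0 < ε → ∃ δ : ℝ, 0 < δ ∧ ∀ v : RN N → ℝ, MemD12 v → normD v < δ →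
    |energy V f (u + v) - energy V f u - innerV V g v| ≤ ε * normD v

/-- `(u_k)` is a `(PS)_d`-sequence for `I_V`: a sequence in `D^{1,2}(ℝ^N)` with `I_V(u_k) → d` and
`∇I_V(u_k) → 0`. -/
def IsPalaisSmale {N : ℕ} (V : RN N → ℝ) (f : ℝ → ℝ) (d : ℝ) (u : ℕ → RN N → ℝ) : Prop :=
  (∀ k, MemD12 (u k)) ∧ Tendsto (fun k => energy V f (u k)) atTop (𝓝 d) ∧
    ∃ g : ℕ → RN N → ℝ, (∀ k, IsEnergyGradient V f (u k) (g k)) ∧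
      Tendsto (fun k => normV V (g k)) atTop (𝓝 0)

end ZeroMass

end

open ZeroMass

/-!
The proof is a profile decomposition in the Hilbert space `D^{1,2}(ℝ^N)`, on which `ℝ^N` acts by
translations.

Whenever translates `u_k(· + z_k)` with `|z_k| → ∞` have a weak limit `w`, this limit solves the limit
problem: the derivative of `I_V` at `u_k` is small uniformly in the test function, and a test function
that is moved to infinity tends weakly to zero and no longer sees `V`
(`IsAlmostCritical.solution_of_weakTo_trans`). By critical growth of `f` and the Sobolev inequality,
nonzero solutions of the limit problem have norm at least some `c > 0` (`exists_norm_lower_bound`), and by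
the asymptotic orthogonality of profiles with separating centres a sequence bounded by `M` has at most
`M² / c²` of them. So there is a maximal finite family of profiles, and what remains of `u_k` after they
are removed vanishes weakly along all translations (`exists_profileFamily`).

Such a remainder `r_k` tends to zero in norm (`IsAlmostCritical.tendsto_norm_remainder`). Indeed
`‖u - u^ε‖_2 ≤ ε ‖∇u‖_2` for the mean value `u^ε(x)` of `u` over the ball `B(x, ε)`, and `u^ε(x)` is a fixed
continuous functional applied to a translate of `u`; so `r_k^ε → 0` uniformly, and `r_k → 0` in measure on
the whole space (`tendstoInMeasure_of_forall_translate`). As `f` is subcritical at infinity and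
supercritical at zero, this gives `∫ f(u_k) r_k → 0`, and then the derivative of `I_V` at `u_k`, applied to
`r_k`, is `‖r_k‖² + o(1)`. The same averages show that weakly null sequences have subsequences that tend to
zero almost everywhere (`exists_subseq_tendsto_ae`), which yields the weak continuity of the lower-order
terms and the Brezis-Lieb splitting of `∫ F(u_k)` into the contributions of the profiles
(`IsProfileFamily.tendsto_integral_primitive`), hence that of the energy.

The Sobolev inequality is available because the assumption on `V⁻` contains `0 < S`
(`PotentialAssumption.sobolevConst_pos`). It makes the space of gradients closed in `L²`, so `D^{1,2}` is
represented by this closed subspace (`D12`), with the embedding `fn` into `L^{2*}`.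
-/

noncomputable section

namespace ZeroMass

/-! ### Weak convergence and profiles in a Hilbert space -/

section Hilbert

variable {H : Type*} [NormedAddCommGroup H] [InnerProductSpace ℝ H]

/-- Weak convergence of the sequence `a` to `b` in a real Hilbert space. -/
def WeakTo (a : ℕ → H) (b : H) : Prop :=
  ∀ v : H, Tendsto (fun k => inner ℝ (a k) v) atTop (𝓝 (inner ℝ b v))

lemma WeakTo.comp {a : ℕ → H} {b : H} (h : WeakTo a b) {σ : ℕ → ℕ} (hσ : Tendsto σ atTop atTop) :
    WeakTo (fun k => a (σ k)) b :=
  fun v => (h v).comp hσ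

lemma WeakTo.add {a a' : ℕ → H} {b b' : H} (h : WeakTo a b) (h' : WeakTo a' b') :
    WeakTo (fun k => a k + a' k) (b + b') := fun v => by
  simpa only [inner_add_left] using (h v).add (h' v)

lemma WeakTo.sub {a a' : ℕ → H} {b b' : H} (h : WeakTo a b) (h' : WeakTo a' b') :
    WeakTo (fun k => a k - a' k) (b - b') := fun v => by
  simpa only [inner_sub_left] using (h v).sub (h' v)

lemma weakTo_const (b : H) : WeakTo (fun _ : ℕ => b) b := fun _ => tendsto_const_nhds

lemma WeakTo.sum {ι : Type*} (s : Finset ι) {a : ι → ℕ → H} {b : ι → H}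
    (h : ∀ i ∈ s, WeakTo (a i) (b i)) : WeakTo (fun k => ∑ i ∈ s, a i k) (∑ i ∈ s, b i) := fun v => by
  simpa only [sum_inner] using tendsto_finsetSum s fun i hi => h i hi v

lemma WeakTo.unique {a : ℕ → H} {b b' : H} (h : WeakTo a b) (h' : WeakTo a b') : b = b' :=
  ext_inner_right ℝ fun v => tendsto_nhds_unique (h v) (h' v)

lemma WeakTo.tendsto_apply [CompleteSpace H] {a : ℕ → H} {b : H} (h : WeakTo a b)
    (ℓ : H →L[ℝ] ℝ) : Tendsto (fun k => ℓ (a k)) atTop (𝓝 (ℓ b)) := by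
  have key : ∀ v, inner ℝ v ((InnerProductSpace.toDual ℝ H).symm ℓ) = ℓ v := fun v => by
    rw [real_inner_comm, InnerProductSpace.toDual_symm_apply]
  simpa only [key] using h ((InnerProductSpace.toDual ℝ H).symm ℓ)

/-- A bounded sequence in a separable Hilbert space has a weakly convergent subsequence. -/
lemma exists_subseq_weakTo [CompleteSpace H] [TopologicalSpace.SeparableSpace H]
    {a : ℕ → H} {M : ℝ} (hM : ∀ k, ‖a k‖ ≤ M) :
    ∃ σ : ℕ → ℕ, StrictMono σ ∧ ∃ b : H, WeakTo (fun k => a (σ k)) b := by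
  let x : ℕ → WeakDual ℝ H := fun k => StrongDual.toWeakDual (InnerProductSpace.toDual ℝ H (a k))
  obtain ⟨ℓ, -, σ, hσ, hlim⟩ := WeakDual.isSeqCompact_closedBall ℝ H 0 M (x := x) (fun k => by
    simpa [x] using hM k)
  refine ⟨σ, hσ, (InnerProductSpace.toDual ℝ H).symm (WeakDual.toStrongDual ℓ), fun v => ?_⟩
  rw [InnerProductSpace.toDual_symm_apply]
  exact ((WeakBilin.eval_continuous (topDualPairing ℝ H) v).tendsto ℓ).comp hlim

/-- If every subsequence has a further subsequence with weak limit `0`, a bounded sequence is weakly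
null. -/
lemma weakTo_zero_of_forall_subseq [CompleteSpace H] [TopologicalSpace.SeparableSpace H]
    {a : ℕ → H} {M : ℝ} (hM : ∀ k, ‖a k‖ ≤ M)
    (h : ∀ σ : ℕ → ℕ, StrictMono σ → ∀ b, WeakTo (fun k => a (σ k)) b → b = 0) : WeakTo a 0 := by
  intro v
  refine tendsto_of_subseq_tendsto fun ns hns => ?_
  obtain ⟨ms, -, hms⟩ := strictMono_subseq_of_tendsto_atTop hns
  obtain ⟨τ, hτ, b, hb⟩ := exists_subseq_weakTo (a := fun k => a (ns (ms k))) fun k => hM _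
  have := h (fun k => ns (ms (τ k))) (hms.comp hτ) b hb
  subst this
  exact ⟨fun k => ms (τ k), hb v⟩

/-- A group `T` of linear isometries indexed by translations: strongly continuous, and `T x a`
tends weakly to `0` as `x → ∞`. -/
structure IsTranslationGroup {X : Type*} [NormedAddCommGroup X] (T : X → H →ₗᵢ[ℝ] H) : Prop where
  zero : ∀ a, T 0 a = a
  add : ∀ x y a, T (x + y) a = T x (T y a)
  continuous : ∀ a, Continuous fun x => T x a
  vanish : ∀ a b, Tendsto (fun x => inner ℝ (T x a) b) (Bornology.cobounded X) (𝓝 0)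

variable {X : Type*} [NormedAddCommGroup X] {T : X → H →ₗᵢ[ℝ] H}

namespace IsTranslationGroup

variable (hT : IsTranslationGroup T)
include hT

lemma neg_apply (x : X) (a : H) : T (-x) (T x a) = a := by
  rw [← hT.add, neg_add_cancel, hT.zero]

lemma apply_neg (x : X) (a : H) : T x (T (-x) a) = a := by
  rw [← hT.add, add_neg_cancel, hT.zero]

lemma inner_left (x : X) (a b : H) : inner ℝ (T x a) b = inner ℝ a (T (-x) b) := by
  conv_lhs => rw [← hT.apply_neg x b]
  exact (T x).inner_map_map _ _

lemma weakTo_const {y : ℕ → X} (hy : Tendsto (fun k => ‖y k‖) atTop atTop) (a : H) :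
    WeakTo (fun k => T (y k) a) 0 := fun v => by
  rw [inner_zero_left]
  exact (hT.vanish a v).comp (tendsto_norm_atTop_iff_cobounded.1 hy)

lemma weakTo_of_tendsto {a : ℕ → H} {b : H} {M : ℝ} (hM : ∀ k, ‖a k‖ ≤ M) (ha : WeakTo a b)
    {h : ℕ → X} {h₀ : X} (hh : Tendsto h atTop (𝓝 h₀)) :
    WeakTo (fun k => T (h k) (a k)) (T h₀ b) := fun v => by
  simp only [hT.inner_left]
  have h1 := ha (T (-h₀) v)
  have h2 : Tendsto (fun k => inner ℝ (a k) (T (-h k) v - T (-h₀) v)) atTop (𝓝 0) := by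
    have h3 : Tendsto (fun k => M * ‖T (-h k) v - T (-h₀) v‖) atTop (𝓝 (M * 0)) := by
      refine Tendsto.const_mul _ ?_
      rw [← tendsto_iff_norm_sub_tendsto_zero]
      exact ((hT.continuous v).tendsto _).comp hh.neg
    rw [mul_zero] at h3
    refine squeeze_zero_norm (fun k => ?_) h3
    exact (norm_inner_le_norm _ _).trans (by gcongr; exact hM k)
  have := h1.add h2
  rw [add_zero] at this
  refine this.congr fun k => ?_
  rw [inner_sub_right]; ring

end IsTranslationGroup

/-- A finite family of profiles of the sequence `U`, along the subsequence `σ`: `w i` is the weak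
limit of `U (σ k)` seen from the centre `y i k`. The index `0` stands for the fixed
centre `0`, where the profile may vanish; the other profiles are nonzero. Distinct centres drift
infinitely far apart. -/
structure IsProfileFamily (T : X → H →ₗᵢ[ℝ] H) (U : ℕ → H) (σ : ℕ → ℕ) {m : ℕ}
    (w : Fin (m + 1) → H) (y : Fin (m + 1) → ℕ → X) : Prop where
  strictMono : StrictMono σ
  center_zero : y 0 = 0
  separated : ∀ i j, i ≠ j → Tendsto (fun k => ‖y j k - y i k‖) atTop atTop
  weakTo : ∀ i, WeakTo (fun k => T (-y i k) (U (σ k))) (w i)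
  ne_zero : ∀ i, i ≠ 0 → w i ≠ 0

/-- What is left of `U` after the translated profiles are removed. -/
def remainder (T : X → H →ₗᵢ[ℝ] H) (U : ℕ → H) (σ : ℕ → ℕ) {m : ℕ}
    (w : Fin (m + 1) → H) (y : Fin (m + 1) → ℕ → X) (k : ℕ) : H :=
  U (σ k) - ∑ i, T (y i k) (w i)

omit [NormedAddCommGroup X] in
lemma norm_remainder_le {U : ℕ → H} {σ : ℕ → ℕ} {m : ℕ} {w : Fin (m + 1) → H}
    {y : Fin (m + 1) → ℕ → X} {M : ℝ} (hM : ∀ k, ‖U k‖ ≤ M) (k : ℕ) :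
    ‖remainder T U σ w y k‖ ≤ M + ∑ i, ‖w i‖ := by
  refine (norm_sub_le _ _).trans (add_le_add (hM _) ((norm_sum_le _ _).trans ?_))
  simp

namespace IsProfileFamily

variable {U : ℕ → H} {σ : ℕ → ℕ} {m : ℕ} {w : Fin (m + 1) → H} {y : Fin (m + 1) → ℕ → X}

lemma tendsto_norm_center (h : IsProfileFamily T U σ w y) {i : Fin (m + 1)} (hi : i ≠ 0) :
    Tendsto (fun k => ‖y i k‖) atTop atTop := by
  simpa [h.center_zero] using h.separated 0 i hi.symm

lemma weakTo_translate (hT : IsTranslationGroup T) (h : IsProfileFamily T U σ w y)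
    {i j : Fin (m + 1)} (hij : i ≠ j) : WeakTo (fun k => T (-y i k) (T (y j k) (w j))) 0 := by
  simp only [← hT.add, neg_add_eq_sub]
  exact hT.weakTo_const (h.separated i j hij) _

/-- Seen from any centre, the translated profiles with indices in `s` have as weak limit the profile
of that centre if its index lies in `s`, and `0` otherwise. -/
lemma weakTo_sum (hT : IsTranslationGroup T) (h : IsProfileFamily T U σ w y)
    (s : Finset (Fin (m + 1))) (i : Fin (m + 1)) :
    WeakTo (fun k => T (-y i k) (∑ j ∈ s, T (y j k) (w j))) (if i ∈ s then w i else 0) := by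
  simp only [map_sum]
  rw [← Finset.sum_ite_eq s i w]
  refine WeakTo.sum s fun j _ => ?_
  split_ifs with hij
  · subst hij
    simp only [hT.neg_apply]
    exact ZeroMass.weakTo_const _
  · exact h.weakTo_translate hT hij

lemma weakTo_remainder (hT : IsTranslationGroup T) (h : IsProfileFamily T U σ w y)
    (i : Fin (m + 1)) : WeakTo (fun k => T (-y i k) (remainder T U σ w y k)) 0 := by
  have := (h.weakTo i).sub (h.weakTo_sum hT Finset.univ i)
  simpa [remainder] using this

/-- Seen from the centre of a profile that is not in `s`, the remainder together with the profiles in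
`s` vanishes weakly. -/
lemma weakTo_remainder_add_sum (hT : IsTranslationGroup T) (h : IsProfileFamily T U σ w y)
    {s : Finset (Fin (m + 1))} {i : Fin (m + 1)} (hi : i ∉ s) :
    WeakTo (fun k => T (-y i k) (remainder T U σ w y k + ∑ j ∈ s, T (y j k) (w j))) 0 := by
  have := (h.weakTo_remainder hT i).add (h.weakTo_sum hT s i)
  rw [if_neg hi, add_zero] at this
  simpa only [map_add] using this

lemma translate_add_sum_insert (hT : IsTranslationGroup T) {s : Finset (Fin (m + 1))}
    {i : Fin (m + 1)} (hi : i ∉ s) (r : H) (k : ℕ) :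
    T (-y i k) (r + ∑ j ∈ s, T (y j k) (w j)) + w i =
      T (-y i k) (r + ∑ j ∈ insert i s, T (y j k) (w j)) := by
  rw [Finset.sum_insert hi, add_left_comm, map_add _ (T (y i k) (w i)), hT.neg_apply, add_comm]

omit [NormedAddCommGroup X] in
lemma norm_translate_add_sum_le {M : ℝ} (hM : ∀ k, ‖U k‖ ≤ M) (s : Finset (Fin (m + 1)))
    (x : X) (k : ℕ) :
    ‖T x (remainder T U σ w y k + ∑ j ∈ s, T (y j k) (w j))‖ ≤
      (M + ∑ j, ‖w j‖) + ∑ j ∈ s, ‖w j‖ := by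
  rw [LinearIsometry.norm_map]
  refine (norm_add_le _ _).trans (add_le_add (norm_remainder_le hM k) ((norm_sum_le _ _).trans ?_))
  simp

lemma tendsto_inner_remainder (hT : IsTranslationGroup T) (h : IsProfileFamily T U σ w y)
    (i : Fin (m + 1)) :
    Tendsto (fun k => inner ℝ (remainder T U σ w y k) (T (y i k) (w i))) atTop (𝓝 0) := by
  have := h.weakTo_remainder hT i (w i)
  simpa [hT.inner_left] using this

/-- Pythagoras: translated profiles are asymptotically orthogonal to one another. -/
lemma tendsto_norm_sum (hT : IsTranslationGroup T) (h : IsProfileFamily T U σ w y) :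
    Tendsto (fun k => ‖∑ i, T (y i k) (w i)‖ ^ 2) atTop (𝓝 (∑ i, ‖w i‖ ^ 2)) := by
  have h1 : ∀ i, Tendsto (fun k => inner ℝ (∑ j, T (y j k) (w j)) (T (y i k) (w i))) atTop
      (𝓝 (‖w i‖ ^ 2)) := fun i => by
    have := h.weakTo_sum hT Finset.univ i (w i)
    simpa only [Finset.mem_univ, if_true, hT.inner_left, neg_neg,
      real_inner_self_eq_norm_sq] using this
  refine (tendsto_finsetSum Finset.univ fun i _ => h1 i).congr fun k => ?_
  rw [← inner_sum, real_inner_self_eq_norm_sq]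

/-- Pythagoras: the remainder is asymptotically orthogonal to the translated profiles. -/
lemma tendsto_norm_sq_sub (hT : IsTranslationGroup T) (h : IsProfileFamily T U σ w y) :
    Tendsto (fun k => ‖U (σ k)‖ ^ 2 - ‖remainder T U σ w y k‖ ^ 2) atTop
      (𝓝 (∑ i, ‖w i‖ ^ 2)) := by
  have h1 := tendsto_finsetSum Finset.univ fun i _ => h.tendsto_inner_remainder hT i
  have h2 := (h1.const_mul 2).add (h.tendsto_norm_sum hT)
  simp only [Finset.sum_const_zero, mul_zero, zero_add] at h2
  refine h2.congr fun k => ?_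
  have : U (σ k) = remainder T U σ w y k + ∑ i, T (y i k) (w i) := by simp [remainder]
  rw [this, norm_add_sq_real, inner_sum]
  ring

/-- The scalar product of the sequence with its remainder is asymptotically the squared norm of the
remainder. -/
lemma tendsto_inner_remainder_sub (hT : IsTranslationGroup T) (h : IsProfileFamily T U σ w y) :
    Tendsto (fun k => inner ℝ (U (σ k)) (remainder T U σ w y k) - ‖remainder T U σ w y k‖ ^ 2)
      atTop (𝓝 0) := by
  have h1 := tendsto_finsetSum Finset.univ fun i _ => h.tendsto_inner_remainder hT i
  simp only [Finset.sum_const_zero] at h1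
  refine h1.congr fun k => ?_
  have : U (σ k) = remainder T U σ w y k + ∑ i, T (y i k) (w i) := by simp [remainder]
  conv_rhs => rw [this]
  rw [inner_add_left, real_inner_self_eq_norm_sq, real_inner_comm, inner_sum]
  ring

lemma sum_norm_sq_le (hT : IsTranslationGroup T) (h : IsProfileFamily T U σ w y) {M : ℝ}
    (hM : ∀ k, ‖U k‖ ≤ M) : ∑ i, ‖w i‖ ^ 2 ≤ M ^ 2 := by
  refine le_of_tendsto' (h.tendsto_norm_sq_sub hT) fun k => ?_
  have := pow_le_pow_left₀ (norm_nonneg _) (hM (σ k)) 2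
  nlinarith [sq_nonneg ‖remainder T U σ w y k‖]

/-- A nonzero weak limit of the remainder, seen from centres that drift away from all the earlier
ones, is one more profile. -/
lemma snoc (hT : IsTranslationGroup T) (h : IsProfileFamily T U σ w y) {τ : ℕ → ℕ}
    (hτ : StrictMono τ) {z : ℕ → X} {b : H} (hb : b ≠ 0)
    (hz : ∀ i, Tendsto (fun k => ‖z k - y i (τ k)‖) atTop atTop)
    (hlim : WeakTo (fun k => T (-z k) (remainder T U σ w y (τ k))) b) :
    IsProfileFamily T U (σ ∘ τ) (Fin.snoc w b : Fin (m + 1 + 1) → H)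
      (Fin.snoc (fun i k => y i (τ k)) z : Fin (m + 1 + 1) → ℕ → X) where
  strictMono := h.strictMono.comp hτ
  center_zero := by
    have h0 : (0 : Fin (m + 1 + 1)) = Fin.castSucc 0 := rfl
    rw [h0, Fin.snoc_castSucc, h.center_zero]
    rfl
  separated := by
    intro i j
    induction i using Fin.lastCases with
    | last =>
      induction j using Fin.lastCases with
      | last => simp
      | cast j =>
        intro _
        simp only [Fin.snoc_last, Fin.snoc_castSucc]
        simpa only [norm_sub_rev] using hz j
    | cast i =>
      induction j using Fin.lastCases with
      | last =>
        intro _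
        simpa only [Fin.snoc_last, Fin.snoc_castSucc] using hz i
      | cast j =>
        intro hij
        simp only [Fin.snoc_castSucc]
        exact (h.separated i j fun e => hij (by rw [e])).comp hτ.tendsto_atTop
  weakTo := by
    intro i
    induction i using Fin.lastCases with
    | last =>
      simp only [Fin.snoc_last, Function.comp]
      have h1 : WeakTo (fun k => T (-z k) (∑ i, T (y i (τ k)) (w i))) (∑ _i : Fin (m + 1), 0) := by
        simp only [map_sum, ← hT.add]
        refine WeakTo.sum _ fun i _ => hT.weakTo_const ?_ _
        simpa only [neg_add_eq_sub, norm_sub_rev] using hz i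
      have := hlim.add h1
      simpa [remainder, map_sub] using this
    | cast i =>
      simp only [Fin.snoc_castSucc, Function.comp]
      exact (h.weakTo i).comp hτ.tendsto_atTop
  ne_zero := by
    intro i
    induction i using Fin.lastCases with
    | last => simpa using hb
    | cast i =>
      intro hi
      simp only [Fin.snoc_castSucc]
      exact h.ne_zero i fun e => hi (by rw [e]; rfl)

/-- If the remainder does not vanish weakly along all translations, a further profile can be
extracted. The new centres drift away from the old ones: along a bounded difference of centres the
remainder would have to vanish weakly. -/
lemma exists_snoc [CompleteSpace H] [TopologicalSpace.SeparableSpace H] [ProperSpace X]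
    (hT : IsTranslationGroup T) (h : IsProfileFamily T U σ w y) {M : ℝ} (hM : ∀ k, ‖U k‖ ≤ M)
    (hne : ¬ ∀ z : ℕ → X, WeakTo (fun k => T (-z k) (remainder T U σ w y k)) 0) :
    ∃ (σ' : ℕ → ℕ) (w' : Fin (m + 1 + 1) → H) (y' : Fin (m + 1 + 1) → ℕ → X),
      IsProfileFamily T U σ' w' y' := by
  push Not at hne
  obtain ⟨z, hz⟩ := hne
  have hbd : ∀ k, ‖remainder T U σ w y k‖ ≤ M + ∑ i, ‖w i‖ := norm_remainder_le hM
  have : ¬ ∀ τ : ℕ → ℕ, StrictMono τ → ∀ b,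
      WeakTo (fun k => T (-z (τ k)) (remainder T U σ w y (τ k))) b → b = 0 := fun hall =>
    hz (weakTo_zero_of_forall_subseq (a := fun k => T (-z k) (remainder T U σ w y k))
      (fun k => by simpa using hbd k) hall)
  push Not at this
  obtain ⟨τ, hτ, b, hlim, hb⟩ := this
  refine ⟨_, _, _, h.snoc hT hτ hb (z := fun k => z (τ k)) (fun i => ?_) hlim⟩
  by_contra hcon
  -- A bounded subsequence of the differences of the centres converges after a further extraction.
  rw [tendsto_norm_atTop_iff_cobounded, Metric.cobounded_eq_cocompact,
    tendsto_iff_forall_eventually_mem] at hcon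
  push Not at hcon
  obtain ⟨s, hs, hfreq⟩ := hcon
  obtain ⟨K, hK, hKs⟩ := mem_cocompact.1 hs
  have hfreq' : ∃ᶠ k in atTop, z (τ k) - y i (τ k) ∈ K :=
    hfreq.mono fun k hk => by_contra fun hk' => hk (hKs hk')
  obtain ⟨ρ, hρ, hρK⟩ := extraction_of_frequently_atTop hfreq'
  obtain ⟨x, -, θ, hθ, hx⟩ := hK.tendsto_subseq hρK
  have h1 : WeakTo (fun k => T (-y i (τ (ρ (θ k)))) (remainder T U σ w y (τ (ρ (θ k))))) 0 :=
    (h.weakTo_remainder hT i).comp ((hτ.comp (hρ.comp hθ)).tendsto_atTop)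
  have h2 := hT.weakTo_of_tendsto (M := M + ∑ i, ‖w i‖) (fun k => by simpa using hbd _) h1 hx.neg
  have h3 : WeakTo (fun k => T (-z (τ (ρ (θ k)))) (remainder T U σ w y (τ (ρ (θ k))))) b :=
    hlim.comp ((hρ.comp hθ).tendsto_atTop)
  refine hb (h3.unique ?_)
  have h4 : ∀ k, -z (τ (ρ (θ k))) =
      -(z (τ (ρ (θ k))) - y i (τ (ρ (θ k)))) + -y i (τ (ρ (θ k))) := fun k => by abel
  simpa only [h4, hT.add, map_zero, Function.comp_apply] using h2

end IsProfileFamily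

/-- **Profile decomposition.** If the nonzero profiles of a bounded sequence have norm bounded below,
finitely many of them exhaust the sequence: the remainder vanishes weakly along all translations.
The number of profiles is at most `M² / c²`, so a family with the maximal number exists. -/
theorem exists_profileFamily [CompleteSpace H] [TopologicalSpace.SeparableSpace H] [ProperSpace X]
    (hT : IsTranslationGroup T) {U : ℕ → H} {M c : ℝ} (hM : ∀ k, ‖U k‖ ≤ M) (hc : 0 < c)
    (hlow : ∀ (τ : ℕ → ℕ) (z : ℕ → X) (b : H), StrictMono τ →
      Tendsto (fun k => ‖z k‖) atTop atTop → WeakTo (fun k => T (-z k) (U (τ k))) b → b ≠ 0 →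
      c ≤ ‖b‖) :
    ∃ (m : ℕ) (σ : ℕ → ℕ) (w : Fin (m + 1) → H) (y : Fin (m + 1) → ℕ → X),
      IsProfileFamily T U σ w y ∧
        ∀ z : ℕ → X, WeakTo (fun k => T (-z k) (remainder T U σ w y k)) 0 := by
  by_contra! hcon
  have hall : ∀ m : ℕ, ∃ (σ : ℕ → ℕ) (w : Fin (m + 1) → H) (y : Fin (m + 1) → ℕ → X),
      IsProfileFamily T U σ w y := by
    intro m
    induction m with
    | zero =>
      obtain ⟨σ, hσ, b, hb⟩ := exists_subseq_weakTo hM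
      refine ⟨σ, fun _ => b, 0, hσ, rfl, fun i j hij => ?_, fun i => ?_, fun i hi => ?_⟩
      · exact absurd (Subsingleton.elim (α := Fin 1) i j) hij
      · simpa [hT.zero] using hb
      · exact absurd (Subsingleton.elim (α := Fin 1) i 0) hi
    | succ m ih =>
      obtain ⟨σ, w, y, h⟩ := ih
      refine h.exists_snoc hT hM fun hz => ?_
      obtain ⟨z, hz'⟩ := hcon m σ w y h
      exact hz' (hz z)
  obtain ⟨m, hm⟩ := exists_nat_gt (M ^ 2 / c ^ 2)
  obtain ⟨σ, w, y, h⟩ := hall m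
  have h1 := h.sum_norm_sq_le hT hM
  rw [Fin.sum_univ_succ] at h1
  have h2 : ∑ _i : Fin m, c ^ 2 ≤ ∑ i : Fin m, ‖w i.succ‖ ^ 2 := by
    refine Finset.sum_le_sum fun i _ => pow_le_pow_left₀ hc.le ?_ 2
    exact hlow σ _ _ h.strictMono (h.tendsto_norm_center (Fin.succ_ne_zero i)) (h.weakTo _)
      (h.ne_zero _ (Fin.succ_ne_zero i))
  rw [Finset.sum_const, Finset.card_univ, Fintype.card_fin, nsmul_eq_mul] at h2
  rw [div_lt_iff₀ (by positivity)] at hm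
  nlinarith [sq_nonneg ‖w 0‖]

end Hilbert

/-! ### The Hilbert space `D^{1,2}` -/

section Space

variable {N : ℕ}

/-- The critical exponent `2*` as an exponent for `Lp`. -/
abbrev critExp (N : ℕ) : ℝ≥0∞ := ENNReal.ofReal (twoStar N)

lemma two_lt_twoStar (hN : 3 ≤ N) : 2 < twoStar N := by
  have : (3 : ℝ) ≤ N := by exact_mod_cast hN
  rw [twoStar, lt_div_iff₀ (by linarith)]
  linarith

instance fact_one_le_critExp [hN : Fact (3 ≤ N)] : Fact (1 ≤ critExp N) :=
  ⟨by
    rw [← ENNReal.ofReal_one]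
    exact ENNReal.ofReal_le_ofReal (by linarith [two_lt_twoStar hN.out])⟩

lemma one_le_critExp [Fact (3 ≤ N)] : 1 ≤ critExp N := Fact.out

lemma IsWeakGradient.congr {u u' : RN N → ℝ} {g g' : RN N → RN N} (h : IsWeakGradient u g)
    (hu : u =ᵐ[volume] u') (hg : g =ᵐ[volume] g') : IsWeakGradient u' g' := by
  refine ⟨h.1.congr hu, h.2.1.congr hg, fun φ hφ hc e => ?_⟩
  have h1 : ∫ x, u' x * fderiv ℝ φ x e = ∫ x, u x * fderiv ℝ φ x e :=
    integral_congr_ae (by filter_upwards [hu] with x hx; rw [hx])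
  have h2 : ∫ x, φ x * inner ℝ (g' x) e = ∫ x, φ x * inner ℝ (g x) e :=
    integral_congr_ae (by filter_upwards [hg] with x hx; rw [hx])
  rw [h1, h2, h.2.2 φ hφ hc e]

/-- The weak gradient is unique almost everywhere. -/
lemma IsWeakGradient.ae_eq {u : RN N → ℝ} {g g' : RN N → RN N} (h : IsWeakGradient u g)
    (h' : IsWeakGradient u g') : g =ᵐ[volume] g' := by
  refine ae_eq_of_integral_contDiff_smul_eq h.2.1 h'.2.1 fun φ hφ hc => ?_
  refine ext_inner_left ℝ fun e => ?_
  have key : ∀ g : RN N → RN N, LocallyIntegrable g volume →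
      inner ℝ e (∫ x, φ x • g x) = ∫ x, φ x * inner ℝ (g x) e := fun g hg => by
    rw [← integral_inner (hg.integrable_smul_left_of_hasCompactSupport hφ.continuous hc)]
    refine integral_congr_ae (Eventually.of_forall fun x => ?_)
    simp only [inner_smul_right, real_inner_comm]
  rw [key g h.2.1, key g' h'.2.1, ← neg_inj, ← h.2.2 φ hφ hc e, ← h'.2.2 φ hφ hc e]

lemma weakGrad_ae_eq {u : RN N → ℝ} {g : RN N → RN N} (hg : MemLp g 2 volume)
    (h : IsWeakGradient u g) : weakGrad u =ᵐ[volume] g := by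
  have hex : ∃ g : RN N → RN N, MemLp g 2 volume ∧ IsWeakGradient u g := ⟨g, hg, h⟩
  rw [weakGrad, dif_pos hex]
  exact hex.choose_spec.2.ae_eq h

variable [Fact (3 ≤ N)]

lemma isWeakGradient_coeFn_iff (u : Lp ℝ (critExp N) (volume : Measure (RN N)))
    (g : Lp (RN N) 2 (volume : Measure (RN N))) :
    IsWeakGradient u g ↔ ∀ φ : RN N → ℝ, ContDiff ℝ ∞ φ → HasCompactSupport φ → ∀ e : RN N,
      ∫ x, u x * fderiv ℝ φ x e = - ∫ x, φ x * inner ℝ (g x) e :=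
  ⟨fun h => h.2.2, fun h => ⟨(Lp.memLp u).locallyIntegrable one_le_critExp,
    (Lp.memLp g).locallyIntegrable one_le_two, h⟩⟩

instance fact_one_le_conjExponent {p : ℝ≥0∞} : Fact (1 ≤ p.conjExponent) := ⟨le_self_add⟩

/-- Integration against a function of the conjugate class, as a functional on `L^p`. -/
def pairing {p : ℝ≥0∞} [Fact (1 ≤ p)] (ψ : RN N → ℝ) (hψ : MemLp ψ p.conjExponent volume) :
    Lp ℝ p (volume : Measure (RN N)) →L[ℝ] ℝ :=
  ((ContinuousLinearMap.mul ℝ ℝ).lpPairing volume p p.conjExponent).flip (hψ.toLp ψ)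

omit [Fact (3 ≤ N)] in
lemma pairing_apply {p : ℝ≥0∞} [Fact (1 ≤ p)] (ψ : RN N → ℝ) (hψ : MemLp ψ p.conjExponent volume)
    (u : Lp ℝ p (volume : Measure (RN N))) : pairing ψ hψ u = ∫ x, u x * ψ x := by
  rw [pairing, ContinuousLinearMap.flip_apply, ContinuousLinearMap.lpPairing_eq_integral]
  refine integral_congr_ae ?_
  filter_upwards [hψ.coeFn_toLp] with x hx
  rw [hx]
  rfl

omit [Fact (3 ≤ N)] in
lemma contDiff_fderiv_apply {φ : RN N → ℝ} (hφ : ContDiff ℝ ∞ φ) (e : RN N) :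
    ContDiff ℝ ∞ fun x => fderiv ℝ φ x e :=
  (hφ.fderiv_right le_rfl).clm_apply contDiff_const

/-- The defect in the weak gradient identity, as a continuous functional of the pair `(u, g)`. -/
def gradDefect (φ : RN N → ℝ) (hφ : ContDiff ℝ ∞ φ) (hc : HasCompactSupport φ) (e : RN N) :
    Lp ℝ (critExp N) (volume : Measure (RN N)) × Lp (RN N) 2 (volume : Measure (RN N)) →L[ℝ] ℝ :=
  (pairing (fun x => fderiv ℝ φ x e) ((contDiff_fderiv_apply hφ e).continuous.memLp_of_hasCompactSupport
    (hc.fderiv_apply ℝ e))).comp (ContinuousLinearMap.fst ℝ _ _) +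
  (innerSL ℝ (((hφ.continuous.smul continuous_const).memLp_of_hasCompactSupport
    (hc.smul_right (f' := fun _ => e)) : MemLp (fun x => φ x • e) 2 volume).toLp _)).comp
      (ContinuousLinearMap.snd ℝ _ _)

lemma gradDefect_apply (φ : RN N → ℝ) (hφ : ContDiff ℝ ∞ φ) (hc : HasCompactSupport φ) (e : RN N)
    (p : Lp ℝ (critExp N) (volume : Measure (RN N)) × Lp (RN N) 2 (volume : Measure (RN N))) :
    gradDefect φ hφ hc e p =
      (∫ x, p.1 x * fderiv ℝ φ x e) + ∫ x, φ x * inner ℝ (p.2 x) e := by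
  rw [gradDefect, add_apply]
  congr 1
  · simp only [ContinuousLinearMap.comp_apply, pairing_apply, ContinuousLinearMap.coe_fst']
  · simp only [ContinuousLinearMap.comp_apply, ContinuousLinearMap.coe_snd', innerSL_apply_apply,
      L2.inner_def]
    refine integral_congr_ae ?_
    filter_upwards [((hφ.continuous.smul continuous_const).memLp_of_hasCompactSupport
      (hc.smul_right (f' := fun _ => e)) : MemLp (fun x => φ x • e) 2 volume).coeFn_toLp] with x hx
    rw [hx]
    simp only [Pi.smul_apply', real_inner_smul_left, real_inner_comm]

/-- The closed subspace of `L^{2*} × L²` of the pairs `(u, ∇u)`. -/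
def gradPairs (N : ℕ) [Fact (3 ≤ N)] : Submodule ℝ
    (Lp ℝ (critExp N) (volume : Measure (RN N)) × Lp (RN N) 2 (volume : Measure (RN N))) :=
  ⨅ (φ : RN N → ℝ) (hφ : ContDiff ℝ ∞ φ) (hc : HasCompactSupport φ) (e : RN N),
    LinearMap.ker (gradDefect φ hφ hc e).toLinearMap

lemma mem_gradPairs {p : Lp ℝ (critExp N) (volume : Measure (RN N)) ×
    Lp (RN N) 2 (volume : Measure (RN N))} : p ∈ gradPairs N ↔ IsWeakGradient p.1 p.2 := by
  simp only [gradPairs, Submodule.mem_iInf, LinearMap.mem_ker, isWeakGradient_coeFn_iff,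
    ContinuousLinearMap.coe_coe, gradDefect_apply, eq_neg_iff_add_eq_zero]

lemma isClosed_gradPairs : IsClosed (gradPairs N : Set
    (Lp ℝ (critExp N) (volume : Measure (RN N)) × Lp (RN N) 2 (volume : Measure (RN N)))) := by
  simp only [gradPairs, Submodule.coe_iInf]
  exact isClosed_iInter fun φ => isClosed_iInter fun hφ => isClosed_iInter fun hc =>
    isClosed_iInter fun e => (gradDefect φ hφ hc e).isClosed_ker

omit [Fact (3 ≤ N)] in
lemma norm_sq_eq_integral (g : Lp (RN N) 2 (volume : Measure (RN N))) :
    ‖g‖ ^ 2 = ∫ x, ‖g x‖ ^ 2 := by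
  rw [← real_inner_self_eq_norm_sq, L2.inner_def]
  simp only [real_inner_self_eq_norm_sq]

omit [Fact (3 ≤ N)] in
lemma sobolevConst_mul_le (u : RN N → ℝ) (hu : MemD12 u) :
    sobolevConst N * (eLpNorm u (critExp N) volume).toReal ^ 2 ≤ normD u ^ 2 := by
  by_cases h0 : u =ᵐ[volume] 0
  · rw [eLpNorm_congr_ae h0]
    simp [sq_nonneg]
  rcases (ENNReal.toReal_nonneg (a := eLpNorm u (critExp N) volume)).eq_or_lt with h1 | h1
  · rw [← h1]
    simp [sq_nonneg]
  have hle : sobolevConst N ≤ normD u ^ 2 / (eLpNorm u (critExp N) volume).toReal ^ 2 := by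
    refine csInf_le ⟨0, ?_⟩ ⟨u, hu, h0, rfl⟩
    rintro t ⟨v, -, -, rfl⟩
    positivity
  rwa [le_div_iff₀ (by positivity)] at hle

lemma sobolevConst_mul_norm_sq_le (p : gradPairs N) :
    sobolevConst N * ‖p.1.1‖ ^ 2 ≤ ‖p.1.2‖ ^ 2 := by
  have hw := mem_gradPairs.1 p.2
  have h := sobolevConst_mul_le p.1.1 ⟨Lp.memLp _, _, Lp.memLp _, hw⟩
  rw [normD, Real.sq_sqrt (integral_nonneg fun _ => by positivity)] at h
  rw [norm_sq_eq_integral, Lp.norm_def]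
  refine h.trans_eq (integral_congr_ae ?_)
  filter_upwards [weakGrad_ae_eq (Lp.memLp _) hw] with x hx
  rw [hx]

/-- The projection `(u, ∇u) ↦ ∇u`. -/
def gradMap (N : ℕ) [Fact (3 ≤ N)] : gradPairs N →L[ℝ] Lp (RN N) 2 (volume : Measure (RN N)) :=
  (ContinuousLinearMap.snd ℝ _ _).comp (gradPairs N).subtypeL

/-- The space `D^{1,2}(ℝ^N)`, realised as the space of the gradients of its elements, with the scalar
product of `L²`. -/
def D12 (N : ℕ) [Fact (3 ≤ N)] : Submodule ℝ (Lp (RN N) 2 (volume : Measure (RN N))) :=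
  LinearMap.range (gradMap N).toLinearMap

/-- The norm of the embedding of `D^{1,2}` into `L^{2*}`. -/
def embConst (N : ℕ) : ℝ := Real.sqrt (sobolevConst N)⁻¹

variable [hS : Fact (0 < sobolevConst N)]

omit [Fact (3 ≤ N)] in
lemma embConst_pos : 0 < embConst N := Real.sqrt_pos.2 (inv_pos.2 hS.out)

lemma norm_fst_le (p : gradPairs N) : ‖p.1.1‖ ≤ embConst N * ‖p.1.2‖ := by
  refine (sq_le_sq₀ (norm_nonneg _) (mul_nonneg embConst_pos.le (norm_nonneg _))).1 ?_
  rw [mul_pow, embConst, Real.sq_sqrt (inv_nonneg.2 hS.out.le), inv_mul_eq_div,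
    le_div_iff₀ hS.out, mul_comm]
  exact sobolevConst_mul_norm_sq_le p

lemma antilipschitz_gradMap : AntilipschitzWith (Real.toNNReal (max (embConst N) 1)) (gradMap N) := by
  refine AddMonoidHomClass.antilipschitz_of_bound _ fun p => ?_
  rw [Real.coe_toNNReal _ (by positivity)]
  have h1 : ‖p‖ = max ‖p.1.1‖ ‖p.1.2‖ := rfl
  have h2 : gradMap N p = p.1.2 := rfl
  rw [h1, h2]
  refine max_le ((norm_fst_le p).trans (by gcongr; exact le_max_left _ _)) ?_
  exact le_mul_of_one_le_left (norm_nonneg _) (le_max_right _ _)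

instance : CompleteSpace (D12 N) := by
  have : CompleteSpace (gradPairs N) := isClosed_gradPairs.completeSpace_coe
  have h : IsClosed (Set.range (gradMap N)) :=
    (antilipschitz_gradMap (N := N)).isClosed_range (gradMap N).uniformContinuous
  have h' : IsClosed (D12 N : Set (Lp (RN N) 2 (volume : Measure (RN N)))) := by
    convert h using 1
    exact LinearMap.coe_range _
  exact h'.completeSpace_coe

instance : TopologicalSpace.SeparableSpace (D12 N) := by
  have : Fact ((2 : ℝ≥0∞) ≠ ⊤) := ⟨ENNReal.ofNat_ne_top⟩
  have : SecondCountableTopology (Lp (RN N) 2 (volume : Measure (RN N))) := inferInstance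
  have : SecondCountableTopology (D12 N) := TopologicalSpace.Subtype.secondCountableTopology _
  exact TopologicalSpace.SecondCountableTopology.to_separableSpace

/-- The pairs `(u, ∇u)` are parametrised by `∇u`. -/
def pairEquiv (N : ℕ) [Fact (3 ≤ N)] [Fact (0 < sobolevConst N)] : gradPairs N ≃ₗ[ℝ] D12 N :=
  LinearEquiv.ofInjective (gradMap N).toLinearMap antilipschitz_gradMap.injective

/-- The embedding of `D^{1,2}` into `L^{2*}`. -/
def fn (N : ℕ) [Fact (3 ≤ N)] [Fact (0 < sobolevConst N)] :
    D12 N →L[ℝ] Lp ℝ (critExp N) (volume : Measure (RN N)) :=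
  LinearMap.mkContinuous ((LinearMap.fst ℝ _ _).comp
    ((gradPairs N).subtype.comp (pairEquiv N).symm.toLinearMap)) (embConst N) fun a => by
      have h := norm_fst_le ((pairEquiv N).symm a)
      have h2 : ((pairEquiv N).symm a).1.2 = a.1 :=
        congrArg Subtype.val ((pairEquiv N).apply_symm_apply a)
      rw [h2] at h
      exact h

lemma norm_fn_le (a : D12 N) : ‖fn N a‖ ≤ embConst N * ‖a‖ := by
  have h := norm_fst_le ((pairEquiv N).symm a)
  have h2 : ((pairEquiv N).symm a).1.2 = a.1 :=
    congrArg Subtype.val ((pairEquiv N).apply_symm_apply a)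
  rw [h2] at h
  exact h

lemma isWeakGradient_fn (a : D12 N) : IsWeakGradient (fn N a) a.1 := by
  have h := mem_gradPairs.1 ((pairEquiv N).symm a).2
  have h2 : ((pairEquiv N).symm a).1.2 = a.1 :=
    congrArg Subtype.val ((pairEquiv N).apply_symm_apply a)
  rw [h2] at h
  exact h

lemma fn_eq_of_isWeakGradient {a : D12 N} {u : Lp ℝ (critExp N) (volume : Measure (RN N))}
    (h : IsWeakGradient u a.1) : fn N a = u := by
  have h1 : pairEquiv N ⟨(u, a.1), mem_gradPairs.2 h⟩ = a := Subtype.ext rfl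
  have h2 : (pairEquiv N).symm a = ⟨(u, a.1), mem_gradPairs.2 h⟩ := by
    rw [LinearEquiv.symm_apply_eq, h1]
  change ((pairEquiv N).symm a).1.1 = u
  rw [h2]

omit hS in
lemma mem_D12_of_isWeakGradient {u : Lp ℝ (critExp N) (volume : Measure (RN N))}
    {g : Lp (RN N) 2 (volume : Measure (RN N))} (h : IsWeakGradient u g) : g ∈ D12 N :=
  ⟨⟨(u, g), mem_gradPairs.2 h⟩, rfl⟩

/-- Every function in `D^{1,2}` represents an element of the Hilbert space. -/
lemma MemD12.exists_rep {u : RN N → ℝ} (hu : MemD12 u) : ∃ a : D12 N, u =ᵐ[volume] fn N a := by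
  obtain ⟨h, g, hg, hw⟩ := hu
  have hw' : IsWeakGradient (h.toLp u) (hg.toLp g) := hw.congr h.coeFn_toLp.symm hg.coeFn_toLp.symm
  refine ⟨⟨hg.toLp g, mem_D12_of_isWeakGradient hw'⟩, ?_⟩
  rw [fn_eq_of_isWeakGradient (a := ⟨hg.toLp g, mem_D12_of_isWeakGradient hw'⟩) hw']
  exact h.coeFn_toLp.symm

lemma memD12_of_ae_eq {u : RN N → ℝ} {a : D12 N} (h : u =ᵐ[volume] fn N a) : MemD12 u :=
  ⟨(Lp.memLp (fn N a)).ae_eq h.symm, a.1, Lp.memLp _,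
    (isWeakGradient_fn a).congr h.symm EventuallyEq.rfl⟩

lemma weakGrad_of_ae_eq {u : RN N → ℝ} {a : D12 N} (h : u =ᵐ[volume] fn N a) :
    weakGrad u =ᵐ[volume] a.1 :=
  weakGrad_ae_eq (Lp.memLp _) ((isWeakGradient_fn a).congr h.symm EventuallyEq.rfl)

lemma normD_of_ae_eq {u : RN N → ℝ} {a : D12 N} (h : u =ᵐ[volume] fn N a) : normD u = ‖a‖ := by
  rw [normD, Submodule.coe_norm, ← Real.sqrt_sq (norm_nonneg a.1), norm_sq_eq_integral]
  congr 1
  refine integral_congr_ae ?_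
  filter_upwards [weakGrad_of_ae_eq h] with x hx
  rw [hx]

/-! ### Translations -/

omit [Fact (3 ≤ N)] hS in
lemma measurePreserving_translate (y : RN N) :
    MeasurePreserving (fun x : RN N => x - y) volume volume :=
  measurePreserving_sub_right volume y

omit [Fact (3 ≤ N)] hS in
lemma IsWeakGradient.translate {u : RN N → ℝ} {g : RN N → RN N} (h : IsWeakGradient u g)
    (hu : LocallyIntegrable (fun x => u (x - y)) volume)
    (hg : LocallyIntegrable (fun x => g (x - y)) volume) :
    IsWeakGradient (fun x => u (x - y)) (fun x => g (x - y)) := by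
  refine ⟨hu, hg, fun φ hφ hc e => ?_⟩
  have h1 := h.2.2 (fun x => φ (x + y)) (hφ.comp (contDiff_id.add contDiff_const))
    (hc.comp_homeomorph (Homeomorph.addRight y)) e
  simp only [fderiv_comp_add_right] at h1
  rw [← integral_sub_right_eq_self _ y, ← integral_sub_right_eq_self (fun x => φ (x + y) * _) y] at h1
  simpa using h1

/-- Translation by `y` on `L^p`: `u ↦ u(· - y)`. -/
def shiftLp (p : ℝ≥0∞) [Fact (1 ≤ p)] (E : Type*) [NormedAddCommGroup E] [NormedSpace ℝ E]
    (y : RN N) : Lp E p (volume : Measure (RN N)) →ₗᵢ[ℝ] Lp E p (volume : Measure (RN N)) :=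
  Lp.compMeasurePreservingₗᵢ ℝ (fun x : RN N => x - y) (measurePreserving_translate y)

omit [Fact (3 ≤ N)] hS in
lemma shiftLp_coeFn (p : ℝ≥0∞) [Fact (1 ≤ p)] {E : Type*} [NormedAddCommGroup E] [NormedSpace ℝ E]
    (y : RN N) (u : Lp E p (volume : Measure (RN N))) :
    shiftLp p E y u =ᵐ[volume] fun x => u (x - y) :=
  Lp.coeFn_compMeasurePreserving u (measurePreserving_translate y)

omit hS in
lemma IsWeakGradient.shiftLp {u : Lp ℝ (critExp N) (volume : Measure (RN N))}
    {g : Lp (RN N) 2 (volume : Measure (RN N))} (h : IsWeakGradient u g) (y : RN N) :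
    IsWeakGradient (shiftLp (critExp N) ℝ y u) (shiftLp 2 (RN N) y g) := by
  refine IsWeakGradient.congr (h.translate (y := y) ?_ ?_) (shiftLp_coeFn _ y u).symm
    (shiftLp_coeFn _ y g).symm
  · exact ((Lp.memLp u).comp_measurePreserving (measurePreserving_translate y)).locallyIntegrable
      one_le_critExp
  · exact ((Lp.memLp g).comp_measurePreserving (measurePreserving_translate y)).locallyIntegrable
      one_le_two

/-- Translation by `y` on `D^{1,2}`: `u ↦ u(· - y)`. -/
def trans (N : ℕ) [Fact (3 ≤ N)] [Fact (0 < sobolevConst N)] (y : RN N) : D12 N →ₗᵢ[ℝ] D12 N where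
  toLinearMap := ((shiftLp 2 (RN N) y).toLinearMap.comp (D12 N).subtype).codRestrict (D12 N)
    fun a => mem_D12_of_isWeakGradient ((isWeakGradient_fn a).shiftLp y)
  norm_map' a := (shiftLp 2 (RN N) y).norm_map a.1

lemma fn_trans (y : RN N) (a : D12 N) :
    fn N (trans N y a) =ᵐ[volume] fun x => fn N a (x - y) := by
  have h : fn N (trans N y a) = shiftLp (critExp N) ℝ y (fn N a) :=
    fn_eq_of_isWeakGradient ((isWeakGradient_fn a).shiftLp y)
  rw [h]
  exact shiftLp_coeFn _ y _

omit [Fact (3 ≤ N)] hS in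
lemma continuous_shiftLp {p : ℝ≥0∞} [Fact (1 ≤ p)] (hp : p ≠ ⊤) {E : Type*} [NormedAddCommGroup E]
    [NormedSpace ℝ E] (u : Lp E p (volume : Measure (RN N))) :
    Continuous fun y : RN N => shiftLp p E y u := by
  have h : Continuous fun y : RN N => (⟨fun x => x - y, by fun_prop⟩ : C(RN N, RN N)) :=
    ContinuousMap.continuous_of_continuous_uncurry _ (by
      simp only [Function.uncurry_def, ContinuousMap.coe_mk]; fun_prop)
  exact Continuous.compMeasurePreservingLp (f := fun _ => u) continuous_const h
    measurePreserving_translate hp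

omit [Fact (3 ≤ N)] hS in
lemma shiftLp_add {p : ℝ≥0∞} [Fact (1 ≤ p)] {E : Type*} [NormedAddCommGroup E] [NormedSpace ℝ E]
    (x y : RN N) (u : Lp E p (volume : Measure (RN N))) :
    shiftLp p E (x + y) u = shiftLp p E x (shiftLp p E y u) := by
  refine Lp.ext ?_
  have h1 := (measurePreserving_translate x).quasiMeasurePreserving.ae (shiftLp_coeFn p y u)
  filter_upwards [shiftLp_coeFn p (x + y) u, shiftLp_coeFn p x (shiftLp p E y u), h1] with t h2 h3 h4
  rw [h2, h3, h4, sub_sub]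

omit [Fact (3 ≤ N)] hS in
lemma shiftLp_zero {p : ℝ≥0∞} [Fact (1 ≤ p)] {E : Type*} [NormedAddCommGroup E] [NormedSpace ℝ E]
    (u : Lp E p (volume : Measure (RN N))) : shiftLp p E 0 u = u := by
  refine Lp.ext ?_
  filter_upwards [shiftLp_coeFn p 0 u] with t h
  rw [h, sub_zero]

omit [Fact (3 ≤ N)] hS in
/-- In `L²`, translations far away are asymptotically orthogonal to everything: functions of compact
support are dense, and their translates have eventually disjoint supports. -/
lemma tendsto_inner_shiftLp {E : Type*} [NormedAddCommGroup E] [InnerProductSpace ℝ E]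
    (a b : Lp E 2 (volume : Measure (RN N))) :
    Tendsto (fun y : RN N => inner ℝ (shiftLp 2 E y a) b) (Bornology.cobounded (RN N)) (𝓝 0) := by
  rw [Metric.tendsto_nhds]
  intro ε hε
  obtain ⟨δ, hδ, hδε⟩ : ∃ δ : ℝ, 0 < δ ∧ δ * ‖b‖ + (‖a‖ + δ) * δ < ε := by
    have hc : Tendsto (fun δ : ℝ => δ * ‖b‖ + (‖a‖ + δ) * δ) (𝓝[>] 0) (𝓝 (0 * ‖b‖ + (‖a‖ + 0) * 0)) :=
      (Continuous.tendsto (by fun_prop) 0).mono_left nhdsWithin_le_nhds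
    rw [zero_mul, mul_zero, add_zero] at hc
    obtain ⟨δ, h1, h2⟩ := ((hc.eventually_lt_const hε).and self_mem_nhdsWithin).exists
    exact ⟨δ, h2, h1⟩
  have happrox : ∀ c : Lp E 2 (volume : Measure (RN N)), ∃ c' : RN N → E, HasCompactSupport c' ∧
      ∃ hm : MemLp c' 2 volume, ‖c - hm.toLp c'‖ ≤ δ := fun c => by
    obtain ⟨c', h1, h2, -, hm⟩ := (Lp.memLp c).exists_hasCompactSupport_eLpNorm_sub_le
      ENNReal.ofNat_ne_top (ε := ENNReal.ofReal δ) (by simpa using hδ)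
    refine ⟨c', h1, hm, ?_⟩
    rw [← Lp.toLp_coeFn c (Lp.memLp c), ← MemLp.toLp_sub, Lp.norm_toLp]
    refine ENNReal.toReal_le_of_le_ofReal hδ.le ?_
    simpa using h2
  obtain ⟨a', ha', hma, hda⟩ := happrox a
  obtain ⟨b', hb', hmb, hdb⟩ := happrox b
  have hfar : ∀ᶠ y : RN N in Bornology.cobounded (RN N), inner ℝ (shiftLp 2 E y (hma.toLp a'))
      (hmb.toLp b') = 0 := by
    obtain ⟨R, hR⟩ := ha'.isBounded.union hb'.isBounded |>.subset_closedBall (0 : RN N)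
    filter_upwards [(tendsto_norm_cobounded_atTop (E := RN N)).eventually_gt_atTop (2 * R)] with y hy
    rw [L2.inner_def]
    refine integral_eq_zero_of_ae ?_
    have h1 := (measurePreserving_translate y).quasiMeasurePreserving.ae hma.coeFn_toLp
    filter_upwards [shiftLp_coeFn 2 y (hma.toLp a'), h1, hmb.coeFn_toLp] with x h2 h3 h4
    rw [h2, h3, h4]
    by_cases hx : b' x = 0
    · simp [hx]
    have hx' : a' (x - y) = 0 := by
      by_contra hne
      have k1 := hR (Or.inl (subset_tsupport _ hne))
      have k2 := hR (Or.inr (subset_tsupport _ hx))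
      rw [mem_closedBall_zero_iff] at k1 k2
      have : ‖y‖ ≤ ‖x‖ + ‖x - y‖ := by
        have := norm_sub_le x (x - y)
        rwa [sub_sub_cancel] at this
      linarith
    simp [hx']
  filter_upwards [hfar] with y hy
  have hsplit : inner ℝ (shiftLp 2 E y a) b = inner ℝ (shiftLp 2 E y (a - hma.toLp a')) b +
      inner ℝ (shiftLp 2 E y (hma.toLp a')) (b - hmb.toLp b') := by
    rw [map_sub, inner_sub_left, inner_sub_right, hy]
    ring
  have hna : ‖hma.toLp a'‖ ≤ ‖a‖ + δ := by
    have := norm_sub_le a (a - hma.toLp a')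
    rw [sub_sub_cancel] at this
    linarith
  rw [Real.dist_eq, sub_zero, hsplit]
  refine (abs_add_le _ _).trans_lt (lt_of_le_of_lt ?_ hδε)
  refine add_le_add ((abs_real_inner_le_norm _ _).trans ?_) ((abs_real_inner_le_norm _ _).trans ?_)
  · rw [LinearIsometry.norm_map]; gcongr
  · rw [LinearIsometry.norm_map]; gcongr

lemma isTranslationGroup_trans : IsTranslationGroup (trans N) where
  zero a := Subtype.ext (shiftLp_zero a.1)
  add x y a := Subtype.ext (shiftLp_add x y a.1)
  continuous a := Continuous.subtype_mk (continuous_shiftLp ENNReal.ofNat_ne_top a.1) _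
  vanish a b := tendsto_inner_shiftLp a.1 b.1

end Space

/-! ### Local averages and convergence in measure -/

section Compactness

variable {N : ℕ}

/-- If `w` pairs with test functions like an element of `L²`, then it is one. -/
lemma memLp_two_of_forall_test {w : RN N → ℝ} (hw : LocallyIntegrable w volume) {C : ℝ}
    (hC : 0 ≤ C) (h : ∀ φ : RN N → ℝ, ContDiff ℝ ∞ φ → HasCompactSupport φ →
      |∫ x, w x * φ x| ≤ C * (eLpNorm φ 2 volume).toReal) :
    MemLp w 2 volume ∧ eLpNorm w 2 volume ≤ ENNReal.ofReal C := by
  have hint : ∀ φ : RN N → ℝ, ContDiff ℝ ∞ φ → HasCompactSupport φ →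
      Integrable (fun x => w x * φ x) volume := fun φ hφ hc => by
    simpa only [smul_eq_mul, mul_comm] using
      hw.integrable_smul_left_of_hasCompactSupport hφ.continuous hc
  let S : Submodule ℝ (Lp ℝ 2 (volume : Measure (RN N))) :=
    { carrier := {φ | ∃ ψ : RN N → ℝ, ContDiff ℝ ∞ ψ ∧ HasCompactSupport ψ ∧ φ =ᵐ[volume] ψ}
      add_mem' := by
        rintro φ φ' ⟨ψ, h1, h2, h3⟩ ⟨ψ', h1', h2', h3'⟩
        exact ⟨ψ + ψ', h1.add h1', h2.add h2', (Lp.coeFn_add φ φ').trans (h3.add h3')⟩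
      zero_mem' := ⟨0, contDiff_const, HasCompactSupport.zero, Lp.coeFn_zero _ _ _⟩
      smul_mem' := by
        rintro c φ ⟨ψ, h1, h2, h3⟩
        exact ⟨c • ψ, contDiff_const.smul h1, h2.smul_left (f := fun _ => c),
          (Lp.coeFn_smul c φ).trans (h3.const_smul c)⟩ }
  have hintS : ∀ φ : S, Integrable (fun x => w x * φ.1 x) volume := by
    rintro ⟨φ, ψ, h1, h2, h3⟩
    refine (hint ψ h1 h2).congr ?_
    filter_upwards [h3] with x hx
    rw [hx]
  let L : S →ₗ[ℝ] ℝ :=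
    { toFun := fun φ => ∫ x, w x * φ.1 x
      map_add' := fun φ φ' => by
        rw [← integral_add (hintS φ) (hintS φ')]
        refine integral_congr_ae ?_
        filter_upwards [Lp.coeFn_add φ.1 φ'.1] with x hx
        rw [Submodule.coe_add, hx, Pi.add_apply, mul_add]
      map_smul' := fun c φ => by
        rw [RingHom.id_apply, smul_eq_mul, ← integral_const_mul]
        refine integral_congr_ae ?_
        filter_upwards [Lp.coeFn_smul c φ.1] with x hx
        rw [Submodule.coe_smul, hx, Pi.smul_apply, smul_eq_mul, mul_left_comm] }
  have hL : ∀ φ : S, ‖L φ‖ ≤ C * ‖φ‖ := by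
    rintro ⟨φ, ψ, h1, h2, h3⟩
    have e1 : L ⟨φ, ψ, h1, h2, h3⟩ = ∫ x, w x * ψ x :=
      integral_congr_ae (by filter_upwards [h3] with x hx; rw [hx])
    have e2 : ‖(⟨φ, ψ, h1, h2, h3⟩ : S)‖ = (eLpNorm ψ 2 volume).toReal := by
      rw [Submodule.coe_norm, Lp.norm_def, eLpNorm_congr_ae h3]
    rw [e1, e2]
    exact h ψ h1 h2
  obtain ⟨G, hG, hGn⟩ := exists_extension_norm_eq S (L.mkContinuous C hL)
  set w' := (InnerProductSpace.toDual ℝ (Lp ℝ 2 (volume : Measure (RN N)))).symm G with hw'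
  have hn : ‖w'‖ ≤ C := by
    rw [hw', LinearIsometryEquiv.norm_map, hGn]
    exact L.mkContinuous_norm_le hC hL
  have hae : w =ᵐ[volume] w' := by
    refine ae_eq_of_integral_contDiff_smul_eq hw ((Lp.memLp w').locallyIntegrable one_le_two)
      fun φ hφ hc => ?_
    have hm : MemLp φ 2 volume := hφ.continuous.memLp_of_hasCompactSupport hc
    have h1 := hG ⟨hm.toLp φ, φ, hφ, hc, hm.coeFn_toLp⟩
    have h2 : G (hm.toLp φ) = ∫ x, φ x • w' x := by
      rw [← InnerProductSpace.toDual_symm_apply (𝕜 := ℝ), L2.inner_def]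
      refine integral_congr_ae ?_
      filter_upwards [hm.coeFn_toLp] with x hx
      rw [hx]
      simp [hw']
    have h3 : L ⟨hm.toLp φ, φ, hφ, hc, hm.coeFn_toLp⟩ = ∫ x, φ x • w x :=
      integral_congr_ae (by filter_upwards [hm.coeFn_toLp] with x hx; rw [hx, smul_eq_mul, mul_comm])
    rw [← h3, ← h2]
    exact h1.symm
  refine ⟨(Lp.memLp w').ae_eq hae.symm, ?_⟩
  rw [eLpNorm_congr_ae hae]
  rw [Lp.norm_def] at hn
  exact ENNReal.le_ofReal_iff_toReal_le (Lp.eLpNorm_ne_top w') hC |>.2 hn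

variable [Fact (3 ≤ N)] [Fact (0 < sobolevConst N)]

lemma locallyIntegrable_fn (a : D12 N) : LocallyIntegrable (fn N a) volume :=
  (isWeakGradient_fn a).1

/-- The difference of a translate of `u` and `u`, tested against `φ`: along the translation the
pairing has derivative `∫ φ(· - y) ⟨∇u, v⟩`. -/
lemma abs_integral_translate_sub_le (a : D12 N) {φ : RN N → ℝ} (hφ : ContDiff ℝ ∞ φ)
    (hc : HasCompactSupport φ) (h : RN N) :
    |∫ x, (fn N a (x + h) - fn N a x) * φ x| ≤ ‖h‖ * ‖a‖ * (eLpNorm φ 2 volume).toReal := by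
  set u : RN N → ℝ := ⇑(fn N a) with hu
  have hul : LocallyIntegrable u volume := locallyIntegrable_fn a
  let ψ : RN N → ℝ := fun z => φ (-z)
  have hψ : ContDiff ℝ ∞ ψ := hφ.comp contDiff_neg
  have hψc : HasCompactSupport ψ := hc.comp_homeomorph (Homeomorph.neg (RN N))
  let B := ContinuousLinearMap.mul ℝ ℝ
  let K : RN N → ℝ := convolution u ψ B volume
  let D : RN N → RN N →L[ℝ] ℝ := convolution u (fderiv ℝ ψ) (B.precompR (RN N)) volume
  have hK : ∀ y, HasFDerivAt K (D y) y := fun y =>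
    hψc.hasFDerivAt_convolution_right B hul (hψ.of_le (by simp)) y
  have hKv : ∀ y, K y = ∫ x, u x * φ (x - y) := fun y => by
    change ∫ x, B (u x) (ψ (y - x)) = _
    simp only [ψ, neg_sub]
    rfl
  have hDv : ∀ y v, D y v = ∫ x, φ (x - y) * inner ℝ (a.1 x) v := fun y v => by
    have hφy : ContDiff ℝ ∞ fun x => φ (x - y) := hφ.comp (contDiff_id.sub contDiff_const)
    have hcy : HasCompactSupport fun x => φ (x - y) := by
      simpa only [sub_eq_add_neg, Function.comp_def, Homeomorph.coe_addRight] using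
        hc.comp_homeomorph (Homeomorph.addRight (-y))
    have h1 := (isWeakGradient_fn a).2.2 _ hφy hcy v
    rw [← neg_inj, ← h1]
    have h2 : D y v = ∫ x, (B.precompR (RN N) (u x) (fderiv ℝ ψ (y - x))) v := by
      refine ContinuousLinearMap.integral_apply ?_ v
      exact (hψc.fderiv ℝ).convolutionExists_right (B.precompR (RN N)) hul
        (hψ.continuous_fderiv (by simp)) y
    rw [h2, ← integral_neg]
    refine integral_congr_ae (Eventually.of_forall fun x => ?_)
    have h3 : fderiv ℝ ψ (y - x) = - fderiv ℝ φ (x - y) := by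
      have hd : HasFDerivAt ψ ((fderiv ℝ φ (-(y - x))).comp (-ContinuousLinearMap.id ℝ (RN N))) (y - x) :=
        (hφ.differentiable (by simp) (-(y - x))).hasFDerivAt.comp (y - x) (hasFDerivAt_id (y - x)).neg
      rw [hd.fderiv, neg_sub]
      ext v
      simp
    have h4 : fderiv ℝ (fun x => φ (x - y)) x = fderiv ℝ φ (x - y) := fderiv_comp_sub y
    simp only [ContinuousLinearMap.precompR_apply, h3, h4]
    simp [B, hu]
  have hDn : ∀ y, ‖D y‖ ≤ ‖a‖ * (eLpNorm φ 2 volume).toReal := fun y => by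
    refine ContinuousLinearMap.opNorm_le_bound _ (by positivity) fun v => ?_
    have hm : MemLp φ 2 (volume : Measure (RN N)) := hφ.continuous.memLp_of_hasCompactSupport hc
    have hm1 : MemLp (fun x => φ (x - y)) 2 volume :=
      hm.comp_measurePreserving (measurePreserving_translate y)
    have hm2 : MemLp (fun x => φ (x - y) • v) 2 volume := by
      refine MemLp.of_le_mul (c := ‖v‖) hm1 (hm1.1.smul_const v) (Eventually.of_forall fun x => ?_)
      rw [norm_smul, mul_comm]
    have h1 : D y v = inner ℝ a.1 (hm2.toLp _) := by
      rw [hDv, L2.inner_def]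
      refine integral_congr_ae ?_
      filter_upwards [hm2.coeFn_toLp] with x hx
      rw [hx, inner_smul_right]
    have h2 : ‖hm2.toLp _‖ ≤ ‖v‖ * (eLpNorm φ 2 volume).toReal := by
      rw [Lp.norm_toLp]
      have h3 : eLpNorm (fun x => φ (x - y) • v) 2 volume ≤
          ENNReal.ofReal ‖v‖ * eLpNorm (fun x => φ (x - y)) 2 volume :=
        eLpNorm_le_mul_eLpNorm_of_ae_le_mul
          (Eventually.of_forall fun x => by rw [norm_smul, mul_comm]) 2
      have h4 : eLpNorm (fun x => φ (x - y)) 2 volume = eLpNorm φ 2 volume :=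
        eLpNorm_comp_measurePreserving hm.1 (measurePreserving_translate y)
      rw [h4] at h3
      have h5 := ENNReal.toReal_mono (ENNReal.mul_ne_top ENNReal.ofReal_ne_top hm.2.ne) h3
      rwa [ENNReal.toReal_mul, ENNReal.toReal_ofReal (norm_nonneg _)] at h5
    rw [h1]
    refine (norm_inner_le_norm _ _).trans ?_
    rw [Submodule.coe_norm]
    calc ‖a.1‖ * ‖hm2.toLp _‖ ≤ ‖a.1‖ * (‖v‖ * (eLpNorm φ 2 volume).toReal) := by gcongr
      _ = _ := by ring
  have hmv := Convex.norm_image_sub_le_of_norm_hasFDerivWithin_le (f := K) (s := Set.univ)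
    (fun y _ => (hK y).hasFDerivWithinAt) (fun y _ => hDn y) convex_univ (Set.mem_univ (0 : RN N))
    (Set.mem_univ h)
  have hint : ∀ y, Integrable (fun x => u x * φ (x - y)) volume := fun y => by
    simpa [ψ, B, ConvolutionExistsAt] using
      hψc.convolutionExists_right B hul hψ.continuous y
  have heq : ∫ x, (u (x + h) - u x) * φ x = K h - K 0 := by
    rw [hKv, hKv, ← integral_add_right_eq_self (fun x => u x * φ (x - h)) h]
    have h0 := hint 0
    have h1 := (hint h).comp_add_right h
    simp only [add_sub_cancel_right, sub_zero] at h0 h1 ⊢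
    rw [← integral_sub h1 h0]
    simp only [sub_mul]
  rw [heq]
  refine hmv.trans_eq ?_
  rw [sub_zero]
  ring

/-- `‖u(· + h) - u‖_2 ≤ |h| ‖∇u‖_2`. -/
lemma eLpNorm_translate_sub_le (a : D12 N) (h : RN N) :
    eLpNorm (fun x => fn N a (x + h) - fn N a x) 2 volume ≤ ENNReal.ofReal (‖h‖ * ‖a‖) := by
  refine (memLp_two_of_forall_test ?_ (by positivity)
    fun φ hφ hc => abs_integral_translate_sub_le a hφ hc h).2
  have hm := (Lp.memLp (fn N a)).comp_measurePreserving (measurePreserving_add_right volume h)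
  exact (hm.sub (Lp.memLp (fn N a))).locallyIntegrable one_le_critExp

/-- Normalised Lebesgue measure on the ball of radius `ε` about the origin. -/
def ballMeasure (N : ℕ) (ε : ℝ) : Measure (RN N) :=
  ProbabilityTheory.cond volume (Metric.ball (0 : RN N) ε)

/-- The mean value over the ball of radius `ε` about the origin, as a functional on `D^{1,2}`. -/
def ballMean (N : ℕ) [Fact (3 ≤ N)] [Fact (0 < sobolevConst N)] (ε : ℝ) : D12 N →L[ℝ] ℝ :=
  ((volume (Metric.ball (0 : RN N) ε))⁻¹.toReal) •
    (pairing ((Metric.ball (0 : RN N) ε).indicator fun _ => (1 : ℝ))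
      (memLp_indicator_const _ Metric.isOpen_ball.measurableSet _
        (Or.inr measure_ball_lt_top.ne))).comp (fn N)

lemma ballMean_eq_integral (ε : ℝ) (a : D12 N) :
    ballMean N ε a = ∫ z, fn N a z ∂(ballMeasure N ε) := by
  rw [ballMean, ballMeasure, ProbabilityTheory.cond, integral_smul_measure,
    smul_apply, ContinuousLinearMap.comp_apply, pairing_apply,
    ← integral_indicator Metric.isOpen_ball.measurableSet]
  congr 1
  refine integral_congr_ae (Eventually.of_forall fun x => ?_)
  by_cases hx : x ∈ Metric.ball (0 : RN N) ε <;> simp [hx]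

lemma ballMean_trans (ε : ℝ) (a : D12 N) (x : RN N) :
    ballMean N ε (trans N (-x) a) = ∫ z, fn N a (z + x) ∂(ballMeasure N ε) := by
  rw [ballMean_eq_integral]
  refine integral_congr_ae ?_
  have h : ballMeasure N ε ≪ volume := ProbabilityTheory.cond_absolutelyContinuous
  filter_upwards [h.ae_le (fn_trans (-x) a)] with z hz
  rw [hz, sub_neg_eq_add]

omit [Fact (3 ≤ N)] [Fact (0 < sobolevConst N)] in
lemma isProbabilityMeasure_ballMeasure {ε : ℝ} (hε : 0 < ε) :
    IsProbabilityMeasure (ballMeasure N ε) :=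
  ProbabilityTheory.cond_isProbabilityMeasure_of_finite
    (Metric.measure_ball_pos volume _ hε).ne' measure_ball_lt_top.ne

omit [Fact (3 ≤ N)] [Fact (0 < sobolevConst N)] in
lemma eLpNorm_two_sq {α : Type*} [MeasurableSpace α] {μ : Measure α} (f : α → ℝ) :
    eLpNorm f 2 μ ^ 2 = ∫⁻ x, ‖f x‖ₑ ^ 2 ∂μ := by
  have := eLpNorm_nnreal_pow_eq_lintegral (μ := μ) (f := f) (p := 2) two_ne_zero
  simpa using this

/-- The local means of `u` at scale `ε` differ from `u` by at most `ε ‖∇u‖_2` in `L²`. -/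
lemma lintegral_ballMean_sub_sq_le (a : D12 N) {ε : ℝ} (hε : 0 < ε) :
    ∫⁻ x, ‖ballMean N ε (trans N (-x) a) - fn N a x‖ₑ ^ 2 ≤ ENNReal.ofReal (ε * ‖a‖) ^ 2 := by
  have := isProbabilityMeasure_ballMeasure (N := N) hε
  set μ := ballMeasure N ε with hμ
  set u : RN N → ℝ := ⇑(fn N a) with hu
  have hum : Measurable u := (Lp.stronglyMeasurable (fn N a)).measurable
  have hint : ∀ x, Integrable (fun z => u (z + x)) μ := fun x => by
    have h1 : MemLp (fun z => u (z + x)) (critExp N) volume :=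
      (Lp.memLp (fn N a)).comp_measurePreserving (measurePreserving_add_right volume x)
    have h2 : IntegrableOn (fun z => u (z + x)) (Metric.ball 0 ε) volume :=
      ((h1.locallyIntegrable one_le_critExp).integrableOn_isCompact
        (isCompact_closedBall 0 ε)).mono_set Metric.ball_subset_closedBall
    exact h2.smul_measure (ENNReal.inv_ne_top.2 (Metric.measure_ball_pos volume _ hε).ne')
  have hpt : ∀ x, ‖ballMean N ε (trans N (-x) a) - u x‖ₑ ^ 2 ≤
      ∫⁻ z, ‖u (z + x) - u x‖ₑ ^ 2 ∂μ := fun x => by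
    have e1 : ballMean N ε (trans N (-x) a) - u x = ∫ z, (u (z + x) - u x) ∂μ := by
      rw [ballMean_trans, integral_sub (hint x) (integrable_const _)]
      simp [hu, hμ]
    rw [e1, ← eLpNorm_two_sq]
    gcongr
    refine (enorm_integral_le_lintegral_enorm _).trans ?_
    rw [← eLpNorm_one_eq_lintegral_enorm]
    exact eLpNorm_le_eLpNorm_of_exponent_le one_le_two ((hint x).sub (integrable_const _)).1
  calc ∫⁻ x, ‖ballMean N ε (trans N (-x) a) - u x‖ₑ ^ 2
      ≤ ∫⁻ x, ∫⁻ z, ‖u (z + x) - u x‖ₑ ^ 2 ∂μ := lintegral_mono hpt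
    _ = ∫⁻ z, (∫⁻ x, ‖u (z + x) - u x‖ₑ ^ 2) ∂μ := by
      refine lintegral_lintegral_swap (Measurable.aemeasurable ?_)
      simp only [Function.uncurry_def]
      fun_prop
    _ ≤ ∫⁻ _z, ENNReal.ofReal (ε * ‖a‖) ^ 2 ∂μ := by
      refine lintegral_mono_ae ?_
      have hmem : ∀ᵐ z ∂μ, z ∈ Metric.ball (0 : RN N) ε :=
        ProbabilityTheory.ae_cond_mem Metric.isOpen_ball.measurableSet
      filter_upwards [hmem] with z hz
      rw [← eLpNorm_two_sq]
      gcongr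
      have h1 := eLpNorm_translate_sub_le a z
      simp only [add_comm _ z] at h1
      refine h1.trans (ENNReal.ofReal_le_ofReal ?_)
      have : ‖z‖ ≤ ε := (mem_ball_zero_iff.1 hz).le
      gcongr
    _ = _ := by simp

lemma continuous_ballMean_trans (ε : ℝ) (a : D12 N) :
    Continuous fun x => ballMean N ε (trans N (-x) a) :=
  (ballMean N ε).continuous.comp ((isTranslationGroup_trans.continuous a).comp continuous_neg)

lemma measure_ballMean_sub_ge_le (a : D12 N) {ε δ : ℝ} (hε : 0 < ε) (hδ : 0 < δ) :
    volume {x | δ ≤ ‖ballMean N ε (trans N (-x) a) - fn N a x‖} ≤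
      ENNReal.ofReal ((ε * ‖a‖ / δ) ^ 2) := by
  have hm : AEMeasurable (fun x => ‖ballMean N ε (trans N (-x) a) - fn N a x‖ₑ ^ 2) volume :=
    (((continuous_ballMean_trans ε a).measurable.sub
      (Lp.stronglyMeasurable (fn N a)).measurable).enorm.pow_const 2).aemeasurable
  have h1 := (mul_meas_ge_le_lintegral₀ hm (ENNReal.ofReal δ ^ 2)).trans
    (lintegral_ballMean_sub_sq_le a hε)
  have h2 : {x | ENNReal.ofReal δ ^ 2 ≤ ‖ballMean N ε (trans N (-x) a) - fn N a x‖ₑ ^ 2} =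
      {x | δ ≤ ‖ballMean N ε (trans N (-x) a) - fn N a x‖} := by
    ext x
    simp only [Set.mem_ofPred_eq]
    rw [ENNReal.pow_le_pow_left_iff two_ne_zero, ← ofReal_norm,
      ENNReal.ofReal_le_ofReal_iff (norm_nonneg _)]
  rw [h2, mul_comm, ← ENNReal.le_div_iff_mul_le (Or.inl (by simpa using hδ)) (Or.inl (by simp))] at h1
  refine h1.trans_eq ?_
  rw [div_pow, ENNReal.ofReal_div_of_pos (by positivity), ENNReal.ofReal_pow (by positivity),
    ENNReal.ofReal_pow hδ.le]

/-- A bounded sequence in `D^{1,2}` tends to zero in measure as soon as its local means do, at every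
scale. -/
lemma tendstoInMeasure_of_ballMean {ν : Measure (RN N)} (hν : ν ≤ volume) {a : ℕ → D12 N} {M : ℝ}
    (hM : ∀ k, ‖a k‖ ≤ M)
    (h : ∀ ε, 0 < ε → TendstoInMeasure ν (fun k x => ballMean N ε (trans N (-x) (a k))) atTop 0) :
    TendstoInMeasure ν (fun k => (fn N (a k) : RN N → ℝ)) atTop 0 := by
  rw [tendstoInMeasure_iff_norm]
  intro δ hδ
  have hM0 : 0 ≤ M := (norm_nonneg _).trans (hM 0)
  rw [ENNReal.tendsto_nhds_zero]
  intro η hη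
  -- The scale is chosen so that the error made by averaging is small in measure.
  obtain ⟨ε, hε, hεη⟩ : ∃ ε : ℝ, 0 < ε ∧ ENNReal.ofReal ((ε * M / (δ / 2)) ^ 2) ≤ η / 2 := by
    have hc : Tendsto (fun ε : ℝ => ENNReal.ofReal ((ε * M / (δ / 2)) ^ 2)) (𝓝[>] 0) (𝓝 0) := by
      have h0 : Tendsto (fun ε : ℝ => ENNReal.ofReal ((ε * M / (δ / 2)) ^ 2)) (𝓝 0)
          (𝓝 (ENNReal.ofReal ((0 * M / (δ / 2)) ^ 2))) :=
        (ENNReal.continuous_ofReal.comp (by fun_prop)).tendsto 0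
      simp only [zero_mul, zero_div, ne_eq, OfNat.ofNat_ne_zero, not_false_eq_true, zero_pow,
        ENNReal.ofReal_zero] at h0
      exact h0.mono_left nhdsWithin_le_nhds
    obtain ⟨ε, h1, h2⟩ := ((hc.eventually_le_const (ENNReal.half_pos hη.ne')).and
      self_mem_nhdsWithin).exists
    exact ⟨ε, h2, h1⟩
  have h1 := ENNReal.tendsto_nhds_zero.1 (tendstoInMeasure_iff_norm.1 (h ε hε) (δ / 2) (half_pos hδ))
    (η / 2) (ENNReal.half_pos hη.ne')
  filter_upwards [h1] with k hk
  have hsub : {x | δ ≤ ‖fn N (a k) x - (0 : RN N → ℝ) x‖} ⊆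
      {x | δ / 2 ≤ ‖ballMean N ε (trans N (-x) (a k)) - (0 : RN N → ℝ) x‖} ∪
      {x | δ / 2 ≤ ‖ballMean N ε (trans N (-x) (a k)) - fn N (a k) x‖} := by
    intro x hx
    by_contra hcon
    simp only [Set.mem_union, Set.mem_ofPred_eq, not_or, not_le, Pi.zero_apply, sub_zero] at hcon hx
    have := norm_sub_le (ballMean N ε (trans N (-x) (a k)))
      (ballMean N ε (trans N (-x) (a k)) - fn N (a k) x)
    rw [sub_sub_cancel] at this
    linarith [hcon.1, hcon.2]
  refine (measure_mono hsub).trans ((measure_union_le _ _).trans ?_)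
  rw [← ENNReal.add_halves η]
  refine add_le_add hk ((hν _).trans ((measure_ballMean_sub_ge_le (a k) hε (half_pos hδ)).trans
    (le_trans (ENNReal.ofReal_le_ofReal ?_) hεη)))
  have := hM k
  gcongr

/-- A bounded sequence in `D^{1,2}` all of whose translates tend weakly to zero tends to zero in
measure on the whole space: its local means tend to zero uniformly. -/
lemma tendstoInMeasure_of_forall_translate {a : ℕ → D12 N} {M : ℝ} (hM : ∀ k, ‖a k‖ ≤ M)
    (h : ∀ z : ℕ → RN N, WeakTo (fun k => trans N (-z k) (a k)) 0) :
    TendstoInMeasure volume (fun k => (fn N (a k) : RN N → ℝ)) atTop 0 := by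
  refine tendstoInMeasure_of_ballMean le_rfl hM fun ε _ => ?_
  rw [tendstoInMeasure_iff_norm]
  intro δ hδ
  have hunif : ∀ᶠ k in atTop, ∀ x, ‖ballMean N ε (trans N (-x) (a k))‖ < δ := by
    by_contra hcon
    obtain ⟨τ, hτ, hτ'⟩ := extraction_of_frequently_atTop (not_eventually.1 hcon)
    push Not at hτ'
    choose x hx using hτ'
    -- Centres along the whole sequence that pass through the bad points.
    let z : ℕ → RN N := Function.extend τ x 0
    have h2 := ((h z).comp hτ.tendsto_atTop).tendsto_apply (ballMean N ε)
    rw [map_zero] at h2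
    have h3 := h2.norm.eventually_lt_const (by simpa using hδ)
    obtain ⟨n, hn⟩ := h3.exists
    have hz : z (τ n) = x n := hτ.injective.extend_apply _ _ _
    rw [hz] at hn
    exact absurd (hx n) (not_le.2 hn)
  refine tendsto_const_nhds.congr' ?_
  filter_upwards [hunif] with k hk
  have : {x | δ ≤ ‖ballMean N ε (trans N (-x) (a k)) - (0 : RN N → ℝ) x‖} = ∅ := by
    ext x
    simpa using hk x
  rw [this, measure_empty]

omit [Fact (3 ≤ N)] [Fact (0 < sobolevConst N)] in
/-- There is a finite measure below Lebesgue measure with the same null sets. -/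
lemma exists_finite_measure_le : ∃ ν : Measure (RN N), IsFiniteMeasure ν ∧ ν ≤ volume ∧
    (volume : Measure (RN N)) ≪ ν := by
  obtain ⟨g, hpos, hm, hlt⟩ := exists_pos_lintegral_lt_of_sigmaFinite
    (volume : Measure (RN N)) one_ne_zero
  refine ⟨volume.withDensity fun x => min (g x : ℝ≥0∞) 1, ?_, ?_, ?_⟩
  · refine isFiniteMeasure_withDensity (ne_of_lt ?_)
    exact (lintegral_mono fun x => min_le_left _ _).trans_lt (hlt.trans ENNReal.one_lt_top)
  · conv_rhs => rw [← withDensity_one (μ := (volume : Measure (RN N)))]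
    exact withDensity_mono (Eventually.of_forall fun x => min_le_right _ _)
  · refine withDensity_absolutelyContinuous' (by fun_prop) (Eventually.of_forall fun x => ?_)
    simp [(hpos x).ne']

/-- Local compactness of the embedding: a bounded, weakly null sequence in `D^{1,2}` has a subsequence
that tends to zero almost everywhere. -/
lemma exists_subseq_tendsto_ae {a : ℕ → D12 N} {M : ℝ} (hM : ∀ k, ‖a k‖ ≤ M) (h : WeakTo a 0) :
    ∃ σ : ℕ → ℕ, StrictMono σ ∧ ∀ᵐ x, Tendsto (fun k => fn N (a (σ k)) x) atTop (𝓝 0) := by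
  obtain ⟨ν, hfin, hle, hac⟩ := exists_finite_measure_le (N := N)
  have hmeas : TendstoInMeasure ν (fun k => (fn N (a k) : RN N → ℝ)) atTop 0 := by
    refine tendstoInMeasure_of_ballMean hle hM fun ε _ => ?_
    refine tendstoInMeasure_of_tendsto_ae
      (fun k => (continuous_ballMean_trans ε (a k)).aestronglyMeasurable)
      (Eventually.of_forall fun x => ?_)
    have h1 := (isTranslationGroup_trans.weakTo_of_tendsto hM h
      (tendsto_const_nhds (x := -x))).tendsto_apply (ballMean N ε)
    simpa only [map_zero, Pi.zero_apply] using h1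
  obtain ⟨σ, hσ, hlim⟩ := hmeas.exists_seq_tendsto_ae
  exact ⟨σ, hσ, hac.ae_le hlim⟩

end Compactness

/-! ### Pointwise inequalities -/

section Nonlinearity

lemma add_rpow_le {q s t : ℝ} (hq : 0 ≤ q) (hs : 0 ≤ s) (ht : 0 ≤ t) :
    (s + t) ^ q ≤ 2 ^ q * (s ^ q + t ^ q) := by
  have h1 : s + t ≤ 2 * max s t := by linarith [le_max_left s t, le_max_right s t]
  have h2 : max s t ^ q ≤ s ^ q + t ^ q := by
    rcases max_choice s t with h | h <;> rw [h]
    · linarith [Real.rpow_nonneg ht q]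
    · linarith [Real.rpow_nonneg hs q]
  calc (s + t) ^ q ≤ (2 * max s t) ^ q := by gcongr
    _ = 2 ^ q * max s t ^ q := Real.mul_rpow (by norm_num) (le_max_of_le_left hs)
    _ ≤ _ := by gcongr

lemma rpow_sub_one_mul_self {q s : ℝ} (hq : 1 < q) (hs : 0 ≤ s) : s ^ (q - 1) * s = s ^ q := by
  rw [← Real.rpow_add_one' hs (by linarith), sub_add_cancel]

/-- Young's inequality, with a small constant in front of one of the terms. -/
lemma rpow_sub_one_mul_le {q : ℝ} (hq : 1 < q) {η : ℝ} (hη : 0 < η) :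
    ∃ C : ℝ, 0 ≤ C ∧ ∀ s t : ℝ, 0 ≤ s → 0 ≤ t → s ^ (q - 1) * t ≤ η * s ^ q + C * t ^ q := by
  refine ⟨(η ^ (q - 1))⁻¹, by positivity, fun s t hs ht => ?_⟩
  rcases le_total t (η * s) with h | h
  · calc s ^ (q - 1) * t ≤ s ^ (q - 1) * (η * s) := by gcongr
      _ = η * s ^ q := by rw [mul_left_comm, rpow_sub_one_mul_self hq hs]
      _ ≤ _ := le_add_of_nonneg_right (by positivity)
  · have h1 : s ≤ t / η := by rwa [le_div_iff₀ hη, mul_comm]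
    calc s ^ (q - 1) * t ≤ (t / η) ^ (q - 1) * t := by
          gcongr
      _ = (η ^ (q - 1))⁻¹ * t ^ q := by
          rw [Real.div_rpow ht hη.le, ← rpow_sub_one_mul_self hq ht]
          ring
      _ ≤ _ := le_add_of_nonneg_left (by positivity)

/-- Young's inequality with the three exponents `q / (q - 2)`, `q`, `q`. -/
lemma mul_mul_le_rpow {q : ℝ} (hq : 2 < q) {η : ℝ} (hη : 0 < η) :
    ∃ C : ℝ, 0 ≤ C ∧ ∀ v s t : ℝ, 0 ≤ v → 0 ≤ s → 0 ≤ t →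
      v * s * t ≤ η * (s ^ q + t ^ q) + C * v ^ (q / (q - 2)) := by
  have hq2 : 0 < q - 2 := by linarith
  refine ⟨((η ^ (2 / (q - 2)))⁻¹), by positivity, fun v s t hv hs ht => ?_⟩
  set m := max s t with hm
  have hm0 : 0 ≤ m := le_max_of_le_left hs
  have h1 : v * s * t ≤ v * m ^ 2 := by
    rw [mul_assoc, sq]
    gcongr
    · exact le_max_left _ _
    · exact le_max_right _ _
  have h2 : m ^ q ≤ s ^ q + t ^ q := by
    rcases max_choice s t with h | h <;> rw [hm, h]
    · linarith [Real.rpow_nonneg ht q]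
    · linarith [Real.rpow_nonneg hs q]
  refine h1.trans ?_
  rcases le_total v (η * m ^ (q - 2)) with h | h
  · have h3 : m ^ (q - 2) * m ^ 2 = m ^ q := by
      rw [← Real.rpow_natCast m 2, ← Real.rpow_add' hm0 (by push_cast; linarith)]
      norm_num
    calc v * m ^ 2 ≤ η * m ^ (q - 2) * m ^ 2 := by gcongr
      _ = η * m ^ q := by rw [mul_assoc, h3]
      _ ≤ η * (s ^ q + t ^ q) := by gcongr
      _ ≤ _ := le_add_of_nonneg_right (by positivity)
  · have h3 : m ^ 2 ≤ (v / η) ^ (2 / (q - 2)) := by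
      have h4 : m ^ (q - 2) ≤ v / η := by rwa [le_div_iff₀ hη, mul_comm]
      calc m ^ 2 = (m ^ (q - 2)) ^ (2 / (q - 2)) := by
            rw [← Real.rpow_mul hm0, mul_div_cancel₀ _ hq2.ne', ← Real.rpow_natCast m 2]
            norm_num
        _ ≤ _ := by gcongr
    calc v * m ^ 2 ≤ v * (v / η) ^ (2 / (q - 2)) := by gcongr
      _ = (η ^ (2 / (q - 2)))⁻¹ * (v ^ (2 / (q - 2)) * v) := by
          rw [Real.div_rpow hv hη.le]; ring
      _ = (η ^ (2 / (q - 2)))⁻¹ * v ^ (q / (q - 2)) := by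
          rw [← Real.rpow_add_one' hv (by positivity)]
          congr 2
          field_simp
          ring
      _ ≤ _ := le_add_of_nonneg_left (by positivity)

variable {N : ℕ} {f : ℝ → ℝ}

namespace GrowthAssumption

lemma hasDerivAt_primitive (hf : GrowthAssumption N f) (s : ℝ) :
    HasDerivAt (primitive f) (f s) s :=
  intervalIntegral.integral_hasDerivAt_right (hf.contDiff.continuous.intervalIntegrable _ _)
    (hf.contDiff.continuous.stronglyMeasurableAtFilter _ _) hf.contDiff.continuous.continuousAt

lemma continuous_primitive (hf : GrowthAssumption N f) : Continuous (primitive f) :=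
  continuous_iff_continuousAt.2 fun s => (hf.hasDerivAt_primitive s).continuousAt

/-- The growth conditions on both sides of `|s| = 1` are stronger than critical growth. -/
lemma exists_critical_bound (hN : 3 ≤ N) (hf : GrowthAssumption N f) : ∃ A : ℝ, 0 < A ∧
    (∀ s, |f s| ≤ A * |s| ^ (twoStar N - 1)) ∧ ∀ s, |primitive f s| ≤ A * |s| ^ twoStar N := by
  obtain ⟨A, p, q, hA, hp2, hp, hq, hlarge, hsmall⟩ := hf.growth
  have h2 := two_lt_twoStar hN
  refine ⟨A, hA, fun s => ?_, fun s => ?_⟩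
  · rcases le_total 1 |s| with h | h
    · refine (hlarge s h).2.1.trans ?_
      gcongr
    · refine (hsmall s h).2.1.trans ?_
      gcongr A * ?_
      exact Real.rpow_le_rpow_of_exponent_ge' (abs_nonneg s) h (by linarith) (by linarith)
  · rcases le_total 1 |s| with h | h
    · refine (hlarge s h).1.trans ?_
      gcongr
    · refine (hsmall s h).1.trans ?_
      gcongr A * ?_
      exact Real.rpow_le_rpow_of_exponent_ge' (abs_nonneg s) h (by linarith) (by linarith)

/-- By critical growth and Young's inequality, `F (a + b) - F a` is controlled by a small multiple of
`|a| ^ 2*` and a large one of `|b| ^ 2*`. -/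
lemma abs_primitive_add_sub_le (hN : 3 ≤ N) (hf : GrowthAssumption N f) {η : ℝ} (hη : 0 < η) :
    ∃ C : ℝ, ∀ a b : ℝ, |primitive f (a + b) - primitive f a| ≤
      η * |a| ^ twoStar N + C * |b| ^ twoStar N := by
  obtain ⟨A, hA, hfA, -⟩ := hf.exists_critical_bound hN
  have h2 := two_lt_twoStar hN
  set q := twoStar N with hq
  obtain ⟨C, hC, hY⟩ := rpow_sub_one_mul_le (q := q) (by linarith) (η := η / (A * 2 ^ q))
    (by positivity)
  refine ⟨η + A * C, fun a b => ?_⟩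
  have hmv : |primitive f (a + b) - primitive f a| ≤ A * (|a| + |b|) ^ (q - 1) * |b| := by
    have h := Convex.norm_image_sub_le_of_norm_hasDerivWithin_le (f := primitive f) (f' := f)
      (s := Metric.closedBall 0 (|a| + |b|)) (x := a) (y := a + b)
      (C := A * (|a| + |b|) ^ (q - 1))
      (fun x _ => (hf.hasDerivAt_primitive x).hasDerivWithinAt) (fun x hx => ?_)
      (convex_closedBall _ _) (by simp) (by simpa using abs_add_le a b)
    · simpa using h
    · rw [mem_closedBall_zero_iff, Real.norm_eq_abs] at hx
      rw [Real.norm_eq_abs]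
      refine (hfA x).trans ?_
      have : 0 ≤ q - 1 := by linarith
      gcongr
  have hY' := hY (|a| + |b|) |b| (by positivity) (abs_nonneg b)
  have hadd := add_rpow_le (q := q) (by linarith) (abs_nonneg a) (abs_nonneg b)
  calc |primitive f (a + b) - primitive f a|
      ≤ A * ((|a| + |b|) ^ (q - 1) * |b|) := by rw [← mul_assoc]; exact hmv
    _ ≤ A * (η / (A * 2 ^ q) * (2 ^ q * (|a| ^ q + |b| ^ q)) + C * |b| ^ q) := by
        gcongr
        refine hY'.trans ?_
        gcongr
    _ = η * |a| ^ q + (η + A * C) * |b| ^ q := by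
        field_simp
        ring

/-- Subcritical growth at infinity and supercritical growth at zero: `f s * r` is controlled by a small
multiple of the critical powers, except where `|r|` is bounded below. -/
lemma abs_mul_le_of_vanishing (hN : 3 ≤ N) (hf : GrowthAssumption N f) {η : ℝ} (hη : 0 < η) :
    ∃ δ C : ℝ, 0 < δ ∧ 0 ≤ C ∧ ∀ s r : ℝ, |f s * r| ≤
      η * (|s| ^ twoStar N + |r| ^ twoStar N) + (if δ ≤ |r| then C else 0) := by
  obtain ⟨A₀, p, q, hA₀, hp2, hp, hq, hlarge, hsmall⟩ := hf.growth
  obtain ⟨A, hA, hfA, -⟩ := hf.exists_critical_bound hN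
  have h2 := two_lt_twoStar hN
  set P := twoStar N with hP
  -- `κ` compares `|r|` with `|s|`; `δ` makes both small.
  set κ : ℝ := min (η / A) 1 with hκ
  have hκ0 : 0 < κ := lt_min (by positivity) one_pos
  obtain ⟨δ, hδ0, hδκ, hδ⟩ : ∃ δ : ℝ, 0 < δ ∧ δ ≤ κ ∧ A₀ * (κ ^ (q - 1))⁻¹ * δ ^ (q - P) ≤ η := by
    have hc : Tendsto (fun δ : ℝ => A₀ * (κ ^ (q - 1))⁻¹ * δ ^ (q - P)) (𝓝[>] 0)
        (𝓝 (A₀ * (κ ^ (q - 1))⁻¹ * 0 ^ (q - P))) := by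
      refine Tendsto.const_mul _ (Tendsto.mono_left ?_ nhdsWithin_le_nhds)
      exact (Real.continuousAt_rpow_const 0 (q - P) (Or.inr (by linarith))).tendsto
    rw [Real.zero_rpow (by linarith), mul_zero] at hc
    obtain ⟨δ, ⟨h1, h3⟩, h4⟩ := (((hc.eventually_le_const hη).and
      ((tendsto_id (α := ℝ) (x := 𝓝 0)).mono_left nhdsWithin_le_nhds |>.eventually_le_const hκ0)).and
      self_mem_nhdsWithin).exists
    exact ⟨δ, h4, h3, h1⟩
  -- `R` is the level above which `|t| ^ p` is negligible against `|t| ^ P`.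
  obtain ⟨R, hR1, hR⟩ : ∃ R : ℝ, 1 ≤ R ∧ A₀ * R ^ (p - P) ≤ η / 2 ^ P := by
    have hc : Tendsto (fun R : ℝ => A₀ * R ^ (p - P)) atTop (𝓝 (A₀ * 0)) := by
      have := tendsto_rpow_neg_atTop (y := P - p) (by linarith)
      rw [neg_sub] at this
      exact this.const_mul _
    rw [mul_zero] at hc
    obtain ⟨R, h1, h3⟩ := ((hc.eventually_le_const (show 0 < η / 2 ^ P by positivity)).and
      (eventually_ge_atTop 1)).exists
    exact ⟨R, h3, h1⟩
  refine ⟨δ, A * R ^ P, hδ0, by positivity, fun s r => ?_⟩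
  have hpos : 0 ≤ η * (|s| ^ P + |r| ^ P) := by positivity
  have hite : (0 : ℝ) ≤ if δ ≤ |r| then A * R ^ P else 0 := by split_ifs <;> positivity
  rw [abs_mul]
  rcases le_total |r| (κ * |s|) with h | h
  · have h1 : |f s| * |r| ≤ η * |s| ^ P := by
      calc |f s| * |r| ≤ (A * |s| ^ (P - 1)) * (κ * |s|) := by gcongr; exact hfA s
        _ = A * κ * |s| ^ P := by
            rw [← rpow_sub_one_mul_self (q := P) (by linarith) (abs_nonneg s)]; ring
        _ ≤ A * (η / A) * |s| ^ P := by gcongr; exact min_le_left _ _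
        _ = _ := by rw [mul_div_cancel₀ _ hA.ne']
    have h3 : 0 ≤ η * |r| ^ P := by positivity
    linarith [mul_add η (|s| ^ P) (|r| ^ P)]
  · by_cases hr : δ ≤ |r|
    · rw [if_pos hr]
      -- `T` bounds both `|s|` and `|r|`.
      set T := |s| + |r| with hT
      rcases le_total T R with hTR | hTR
      · have h1 : |f s| * |r| ≤ A * R ^ P := by
          calc |f s| * |r| ≤ (A * |s| ^ (P - 1)) * |r| := by gcongr; exact hfA s
            _ ≤ (A * R ^ (P - 1)) * R := by
                have e1 : |s| ≤ R := by linarith [abs_nonneg r]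
                have e2 : |r| ≤ R := by linarith [abs_nonneg s]
                have e3 : 0 ≤ P - 1 := by linarith
                gcongr
            _ = _ := by rw [mul_assoc, rpow_sub_one_mul_self (by linarith) (by linarith)]
        linarith
      · have hT0 : 0 < T := by linarith
        have h1 : |f s| ≤ A₀ * T ^ (p - 1) := by
          have e3 : 0 ≤ p - 1 := by linarith
          rcases le_total 1 |s| with hs | hs
          · refine (hlarge s hs).2.1.trans ?_
            gcongr
            linarith [abs_nonneg r]
          · refine (hsmall s hs).2.1.trans ?_
            gcongr A₀ * ?_
            exact (Real.rpow_le_one (abs_nonneg s) hs (by linarith)).trans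
              (Real.one_le_rpow (hR1.trans hTR) e3)
        have h3 : |f s| * |r| ≤ η * (|s| ^ P + |r| ^ P) := by
          calc |f s| * |r| ≤ (A₀ * T ^ (p - 1)) * T := by
                gcongr
                linarith [abs_nonneg s]
            _ = A₀ * T ^ (p - P) * T ^ P := by
                rw [mul_assoc, rpow_sub_one_mul_self (by linarith) hT0.le, mul_assoc,
                  ← Real.rpow_add hT0, sub_add_cancel]
            _ ≤ (η / 2 ^ P) * (2 ^ P * (|s| ^ P + |r| ^ P)) := by
                gcongr
                · refine le_trans ?_ hR
                  gcongr A₀ * ?_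
                  exact Real.rpow_le_rpow_of_nonpos (by linarith) hTR (by linarith)
                · exact add_rpow_le (by linarith) (abs_nonneg s) (abs_nonneg r)
            _ = _ := by field_simp
        have h4 : 0 ≤ A * R ^ P := by positivity
        linarith
    · rw [if_neg hr, add_zero]
      push Not at hr
      have hs : |s| ≤ |r| / κ := by rwa [le_div_iff₀ hκ0, mul_comm]
      have hs1 : |s| ≤ 1 := hs.trans ((div_le_one hκ0).2 (hr.le.trans hδκ))
      have e3 : 0 ≤ q - 1 := by linarith
      have h1 : |f s| * |r| ≤ η * |r| ^ P := by
        calc |f s| * |r| ≤ (A₀ * (|r| / κ) ^ (q - 1)) * |r| := by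
              gcongr
              refine (hsmall s hs1).2.1.trans ?_
              gcongr
          _ = A₀ * (κ ^ (q - 1))⁻¹ * (|r| ^ (q - P) * |r| ^ P) := by
              rw [Real.div_rpow (abs_nonneg r) hκ0.le,
                ← Real.rpow_add' (abs_nonneg r) (by linarith), sub_add_cancel,
                ← rpow_sub_one_mul_self (q := q) (by linarith) (abs_nonneg r)]
              ring
          _ ≤ A₀ * (κ ^ (q - 1))⁻¹ * (δ ^ (q - P) * |r| ^ P) := by
              have e4 : 0 ≤ q - P := by linarith
              gcongr
          _ = A₀ * (κ ^ (q - 1))⁻¹ * δ ^ (q - P) * |r| ^ P := by ring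
          _ ≤ η * |r| ^ P := by gcongr
      have h3 : 0 ≤ η * |s| ^ P := by positivity
      linarith [mul_add η (|s| ^ P) (|r| ^ P)]

end GrowthAssumption

end Nonlinearity

/-! ### Convergence of the lower-order terms -/

section Integrals

/-- A criterion of Brezis-Lieb type: integrals tend to zero if the integrands tend to zero almost
everywhere and, for every `η > 0`, are dominated by `η` times a family with bounded integrals plus a
fixed integrable function. -/
lemma tendsto_integral_abs_of_dominated {α : Type*} [MeasurableSpace α] {μ : Measure α}
    {h B : ℕ → α → ℝ} {M : ℝ} (hm : ∀ k, AEStronglyMeasurable (h k) μ)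
    (hB : ∀ k, Integrable (B k) μ) (hB0 : ∀ k x, 0 ≤ B k x) (hM : ∀ k, ∫ x, B k x ∂μ ≤ M)
    (hdom : ∀ η : ℝ, 0 < η → ∃ D : α → ℝ, Integrable D μ ∧ ∀ k x, |h k x| ≤ η * B k x + D x)
    (hlim : ∀ᵐ x ∂μ, Tendsto (fun k => h k x) atTop (𝓝 0)) :
    Tendsto (fun k => ∫ x, |h k x| ∂μ) atTop (𝓝 0) := by
  have hint : ∀ k, Integrable (fun x => |h k x|) μ := fun k => by
    obtain ⟨D, hD, hle⟩ := hdom 1 one_pos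
    refine (((hB k).const_mul 1).add hD).mono' (hm k).norm (Eventually.of_forall fun x => ?_)
    simpa using hle k x
  have key : ∀ η : ℝ, 0 < η → Tendsto (fun k => ∫ x, max (|h k x| - η * B k x) 0 ∂μ) atTop (𝓝 0) := by
    intro η hη
    obtain ⟨D, hD, hle⟩ := hdom η hη
    have h0 : ∫ _x : α, (0 : ℝ) ∂μ = 0 := by simp
    nth_rewrite 2 [← h0]
    refine tendsto_integral_of_dominated_convergence (fun x => |D x|)
      (fun k => (((hint k).1.sub ((hB k).1.const_mul η)).sup aestronglyMeasurable_const)) hD.abs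
      (fun k => Eventually.of_forall fun x => ?_) ?_
    · rw [Real.norm_eq_abs, abs_of_nonneg (le_max_right _ _)]
      exact max_le (by linarith [hle k x, le_abs_self (D x)]) (abs_nonneg _)
    · filter_upwards [hlim] with x hx
      refine squeeze_zero (fun k => le_max_right _ _) (fun k => ?_) (by simpa using hx.abs)
      exact max_le (by linarith [mul_nonneg hη.le (hB0 k x)]) (abs_nonneg _)
  have hM0 : 0 ≤ M := (integral_nonneg (hB0 0)).trans (hM 0)
  rw [Metric.tendsto_nhds]
  intro ε hε
  have hη : 0 < ε / (2 * (M + 1)) := by positivity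
  filter_upwards [(key _ hη).eventually_lt_const (half_pos hε)] with k hk
  rw [Real.dist_eq, sub_zero, abs_of_nonneg (integral_nonneg fun x => abs_nonneg _)]
  have hW : Integrable (fun x => max (|h k x| - ε / (2 * (M + 1)) * B k x) 0) μ :=
    (((hint k).sub ((hB k).const_mul _)).sup (integrable_zero _ _ _))
  calc ∫ x, |h k x| ∂μ
      ≤ ∫ x, (max (|h k x| - ε / (2 * (M + 1)) * B k x) 0 + ε / (2 * (M + 1)) * B k x) ∂μ := by
        refine integral_mono (hint k) (hW.add ((hB k).const_mul _)) fun x => ?_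
        linarith [le_max_left (|h k x| - ε / (2 * (M + 1)) * B k x) 0]
    _ = (∫ x, max (|h k x| - ε / (2 * (M + 1)) * B k x) 0 ∂μ) +
          ε / (2 * (M + 1)) * ∫ x, B k x ∂μ := by
        rw [integral_add hW ((hB k).const_mul _), integral_const_mul]
    _ < ε / 2 + ε / (2 * (M + 1)) * (M + 1) := by
        have := hM k
        refine add_lt_add_of_lt_of_le hk ?_
        gcongr
        linarith
    _ = ε := by field_simp; ring

variable {N : ℕ} [hN : Fact (3 ≤ N)] [hS : Fact (0 < sobolevConst N)]

lemma measurable_fn (a : D12 N) : Measurable (fn N a) :=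
  (Lp.stronglyMeasurable (fn N a)).measurable

omit hS in
lemma toReal_critExp : (critExp N).toReal = twoStar N :=
  ENNReal.toReal_ofReal (by linarith [two_lt_twoStar hN.out])

omit hS in
lemma critExp_ne_zero : critExp N ≠ 0 := by
  simpa using (by linarith [two_lt_twoStar hN.out] : 0 < twoStar N)

lemma integrable_abs_fn_rpow (a : D12 N) : Integrable (fun x => |fn N a x| ^ twoStar N) volume := by
  have := (Lp.memLp (fn N a)).integrable_norm_rpow critExp_ne_zero ENNReal.ofReal_ne_top
  simpa only [toReal_critExp, Real.norm_eq_abs] using this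

lemma integral_abs_fn_rpow (a : D12 N) : ∫ x, |fn N a x| ^ twoStar N = ‖fn N a‖ ^ twoStar N := by
  have h2 : 0 < twoStar N := by linarith [two_lt_twoStar hN.out]
  have h0 : 0 ≤ ∫ x, |fn N a x| ^ twoStar N := integral_nonneg fun x => by positivity
  rw [Lp.norm_def, MemLp.eLpNorm_eq_integral_rpow_norm critExp_ne_zero ENNReal.ofReal_ne_top
    (Lp.memLp _), toReal_critExp]
  simp only [Real.norm_eq_abs]
  rw [ENNReal.toReal_ofReal (by positivity), ← Real.rpow_mul h0, inv_mul_cancel₀ h2.ne',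
    Real.rpow_one]

lemma integral_abs_fn_rpow_le {a : D12 N} {M : ℝ} (hM : ‖a‖ ≤ M) :
    ∫ x, |fn N a x| ^ twoStar N ≤ (embConst N * M) ^ twoStar N := by
  have h2 : 0 < twoStar N := by linarith [two_lt_twoStar hN.out]
  have h3 := embConst_pos (N := N)
  rw [integral_abs_fn_rpow]
  gcongr
  exact (norm_fn_le a).trans (by gcongr)

lemma fn_add (a b : D12 N) : fn N (a + b) =ᵐ[volume] fun x => fn N a x + fn N b x := by
  rw [map_add]
  exact Lp.coeFn_add _ _

lemma fn_smul (c : ℝ) (a : D12 N) : fn N (c • a) =ᵐ[volume] fun x => c * fn N a x := by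
  rw [map_smul]
  exact Lp.coeFn_smul _ _

lemma fn_zero : fn N (0 : D12 N) =ᵐ[volume] 0 := by
  rw [map_zero]
  exact Lp.coeFn_zero _ _ _

/-- To prove that real numbers attached to a weakly null sequence converge, it suffices to treat
subsequences that tend to zero almost everywhere. -/
lemma WeakTo.tendsto_of_ae {a : ℕ → D12 N} {M : ℝ} (hM : ∀ k, ‖a k‖ ≤ M) (ha : WeakTo a 0)
    {c : ℕ → ℝ} {l : ℝ} (h : ∀ σ : ℕ → ℕ,
      (∀ᵐ x, Tendsto (fun k => fn N (a (σ k)) x) atTop (𝓝 0)) →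
        Tendsto (fun k => c (σ k)) atTop (𝓝 l)) : Tendsto c atTop (𝓝 l) := by
  refine tendsto_of_subseq_tendsto fun ns hns => ?_
  obtain ⟨τ, -, hτ⟩ := exists_subseq_tendsto_ae (fun k => hM (ns k)) (ha.comp hns)
  exact ⟨τ, h (fun k => ns (τ k)) hτ⟩

/-! ### The potential term -/

/-- The class of potentials `L^{N/2}`, with the real-valued integral in place of the `L^p` norm. -/
structure IsHalfIntegrable (V : RN N → ℝ) : Prop where
  aestronglyMeasurable : AEStronglyMeasurable V volume
  integrable : Integrable (fun x => |V x| ^ ((N : ℝ) / 2)) volume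

omit hS in
lemma PotentialAssumption.isHalfIntegrable {V : RN N → ℝ} (hV : PotentialAssumption V) :
    IsHalfIntegrable V := by
  have hN' : (3 : ℝ) ≤ N := by exact_mod_cast hN.out
  refine ⟨hV.memLp_half.1, ?_⟩
  have := hV.memLp_half.integrable_norm_rpow (by have := hN.out; simp; omega)
    ENNReal.ofReal_ne_top
  rwa [ENNReal.toReal_ofReal (by positivity)] at this

omit hS in
lemma isHalfIntegrable_zero : IsHalfIntegrable (0 : RN N → ℝ) := by
  have hN' : (3 : ℝ) ≤ N := by exact_mod_cast hN.out
  refine ⟨aestronglyMeasurable_const, ?_⟩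
  simp [Real.zero_rpow (show (N : ℝ) / 2 ≠ 0 by positivity)]

omit hS in
lemma twoStar_div : twoStar N / (twoStar N - 2) = (N : ℝ) / 2 := by
  have hN' : (3 : ℝ) ≤ N := by exact_mod_cast hN.out
  have h : (N : ℝ) - 2 ≠ 0 := by linarith
  have h1 : twoStar N - 2 = 4 / (N - 2) := by rw [twoStar]; field_simp; ring
  rw [h1, twoStar]
  field_simp
  norm_num

omit hS in
lemma abs_mul_mul_le {η : ℝ} (hη : 0 < η) : ∃ C : ℝ, 0 ≤ C ∧ ∀ v s t : ℝ,
    |v * s * t| ≤ η * (|s| ^ twoStar N + |t| ^ twoStar N) + C * |v| ^ ((N : ℝ) / 2) := by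
  obtain ⟨C, hC, h⟩ := mul_mul_le_rpow (two_lt_twoStar hN.out) hη
  refine ⟨C, hC, fun v s t => ?_⟩
  rw [abs_mul, abs_mul, ← twoStar_div]
  exact h _ _ _ (abs_nonneg v) (abs_nonneg s) (abs_nonneg t)

lemma integrable_potential {V : RN N → ℝ} (hV : IsHalfIntegrable V) (a b : D12 N) :
    Integrable (fun x => V x * fn N a x * fn N b x) volume := by
  obtain ⟨C, -, hC⟩ := abs_mul_mul_le (N := N) one_pos
  refine ((((integrable_abs_fn_rpow a).add (integrable_abs_fn_rpow b)).const_mul 1).add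
    (hV.integrable.const_mul C)).mono' ?_ (Eventually.of_forall fun x => hC _ _ _)
  exact (hV.aestronglyMeasurable.mul (measurable_fn a).aestronglyMeasurable).mul
    (measurable_fn b).aestronglyMeasurable

lemma exists_potential_bound {V : RN N → ℝ} (hV : IsHalfIntegrable V) (M : ℝ) :
    ∃ B : ℝ, ∀ a : D12 N, ‖a‖ ≤ M → ∫ x, |V x * fn N a x * fn N a x| ≤ B := by
  obtain ⟨C, hC0, hC⟩ := abs_mul_mul_le (N := N) one_pos
  refine ⟨((embConst N * M) ^ twoStar N + (embConst N * M) ^ twoStar N) +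
    C * ∫ x, |V x| ^ ((N : ℝ) / 2), fun a ha => ?_⟩
  have hi := integrable_abs_fn_rpow a
  have h1 : ∫ x, |V x * fn N a x * fn N a x| ≤
      ∫ x, (1 * (|fn N a x| ^ twoStar N + |fn N a x| ^ twoStar N) + C * |V x| ^ ((N : ℝ) / 2)) :=
    integral_mono (integrable_potential hV a a).abs
      (((hi.add hi).const_mul 1).add (hV.integrable.const_mul C)) fun x => hC _ _ _
  refine h1.trans ?_
  have hi2 : Integrable (fun x => 1 * (|fn N a x| ^ twoStar N + |fn N a x| ^ twoStar N)) volume :=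
    (hi.add hi).const_mul 1
  rw [integral_add hi2 (hV.integrable.const_mul C), integral_const_mul,
    integral_const_mul, integral_add hi hi, one_mul]
  have := integral_abs_fn_rpow_le ha
  gcongr

lemma tendsto_potential_sq_zero {V : RN N → ℝ} (hV : IsHalfIntegrable V) {a : ℕ → D12 N} {M : ℝ}
    (hM : ∀ k, ‖a k‖ ≤ M) (ha : WeakTo a 0) :
    Tendsto (fun k => ∫ x, |V x * fn N (a k) x * fn N (a k) x|) atTop (𝓝 0) := by
  refine ha.tendsto_of_ae hM fun σ hσ => ?_
  refine tendsto_integral_abs_of_dominated (B := fun k x => 2 * |fn N (a (σ k)) x| ^ twoStar N)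
    (M := 2 * (embConst N * M) ^ twoStar N) (fun k => (integrable_potential hV _ _).1)
    (fun k => (integrable_abs_fn_rpow _).const_mul 2) (fun k x => by positivity) (fun k => ?_)
    (fun η hη => ?_) ?_
  · rw [integral_const_mul]
    have := integral_abs_fn_rpow_le (hM (σ k))
    gcongr
  · obtain ⟨C, -, hC⟩ := abs_mul_mul_le (N := N) hη
    refine ⟨_, hV.integrable.const_mul C, fun k x => ?_⟩
    rw [two_mul]
    exact hC _ _ _
  · filter_upwards [hσ] with x hx
    simpa using (hx.const_mul (V x)).mul hx

/-- The potential term is weakly continuous: `∫ V a_k b_k → 0` if `a_k ⇀ 0` and `b_k` is bounded. -/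
lemma tendsto_potential_zero {V : RN N → ℝ} (hV : IsHalfIntegrable V) {a b : ℕ → D12 N} {M M' : ℝ}
    (hM : ∀ k, ‖a k‖ ≤ M) (hM' : ∀ k, ‖b k‖ ≤ M') (ha : WeakTo a 0) :
    Tendsto (fun k => ∫ x, V x * fn N (a k) x * fn N (b k) x) atTop (𝓝 0) := by
  obtain ⟨B, hB⟩ := exists_potential_bound hV M'
  have hB0 : 0 ≤ B := (integral_nonneg fun x => abs_nonneg _).trans (hB (b 0) (hM' 0))
  rw [Metric.tendsto_nhds]
  intro ε hε
  set η : ℝ := ε / (2 * (B + 1)) with hη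
  have hη0 : 0 < η := by positivity
  filter_upwards [(tendsto_potential_sq_zero hV hM ha).eventually_lt_const
    (show 0 < η * (ε / 2) by positivity)] with k hk
  rw [Real.dist_eq, sub_zero]
  have hpt : ∀ x, |V x * fn N (a k) x * fn N (b k) x| ≤
      η⁻¹ * |V x * fn N (a k) x * fn N (a k) x| + η * |V x * fn N (b k) x * fn N (b k) x| := by
    intro x
    simp only [abs_mul, mul_assoc]
    have h1 : |fn N (a k) x| * |fn N (b k) x| ≤
        η⁻¹ * (|fn N (a k) x| * |fn N (a k) x|) + η * (|fn N (b k) x| * |fn N (b k) x|) := by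
      have h2 : 0 ≤ η⁻¹ * (|fn N (a k) x| - η * |fn N (b k) x|) ^ 2 := by positivity
      have h3 : η⁻¹ * (|fn N (a k) x| - η * |fn N (b k) x|) ^ 2 =
          η⁻¹ * (|fn N (a k) x| * |fn N (a k) x|) + η * (|fn N (b k) x| * |fn N (b k) x|) -
            2 * (|fn N (a k) x| * |fn N (b k) x|) := by
        field_simp; ring
      have h4 : 0 ≤ |fn N (a k) x| * |fn N (b k) x| := by positivity
      linarith
    calc |V x| * (|fn N (a k) x| * |fn N (b k) x|) ≤ |V x| *
          (η⁻¹ * (|fn N (a k) x| * |fn N (a k) x|) + η * (|fn N (b k) x| * |fn N (b k) x|)) := by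
          gcongr
      _ = _ := by ring
  have ha' := (integrable_potential hV (a k) (a k)).abs
  have hb' := (integrable_potential hV (b k) (b k)).abs
  calc |∫ x, V x * fn N (a k) x * fn N (b k) x|
      ≤ ∫ x, |V x * fn N (a k) x * fn N (b k) x| := abs_integral_le_integral_abs
    _ ≤ ∫ x, (η⁻¹ * |V x * fn N (a k) x * fn N (a k) x| +
          η * |V x * fn N (b k) x * fn N (b k) x|) :=
        integral_mono (integrable_potential hV _ _).abs
          ((ha'.const_mul _).add (hb'.const_mul _)) hpt
    _ = η⁻¹ * (∫ x, |V x * fn N (a k) x * fn N (a k) x|) +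
          η * ∫ x, |V x * fn N (b k) x * fn N (b k) x| := by
        rw [integral_add (ha'.const_mul _) (hb'.const_mul _), integral_const_mul,
          integral_const_mul]
    _ < η⁻¹ * (η * (ε / 2)) + η * (B + 1) := by
        refine add_lt_add_of_lt_of_le (by gcongr) ?_
        gcongr
        linarith [hB (b k) (hM' k)]
    _ = ε := by rw [hη]; field_simp; ring

/-- Hölder's inequality for the potential term. -/
lemma integral_abs_potential_le {V : RN N → ℝ} (hV : IsHalfIntegrable V) (a : D12 N) :
    ∫ x, |V x| * fn N a x ^ 2 ≤
      (∫ x, |V x| ^ ((N : ℝ) / 2)) ^ (2 / (N : ℝ)) * ‖fn N a‖ ^ 2 := by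
  have hN' : (3 : ℝ) ≤ N := by exact_mod_cast hN.out
  have hN2 : (N : ℝ) - 2 ≠ 0 := by linarith
  have h2 := two_lt_twoStar hN.out
  have hpq : Real.HolderConjugate ((N : ℝ) / 2) (twoStar N / 2) := by
    rw [Real.holderConjugate_iff]
    refine ⟨by linarith, ?_⟩
    rw [twoStar]
    field_simp
    ring
  have hsq : ∀ x, |fn N a x ^ 2| ^ (twoStar N / 2) = |fn N a x| ^ twoStar N := fun x => by
    rw [abs_pow, ← Real.rpow_natCast, ← Real.rpow_mul (abs_nonneg _)]
    congr 1
    push_cast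
    ring
  have hm1 : MemLp (fun x => |V x|) (ENNReal.ofReal ((N : ℝ) / 2)) volume := by
    refine (integrable_norm_rpow_iff hV.aestronglyMeasurable.norm (by have := hN.out; simp; omega)
      ENNReal.ofReal_ne_top).1 ?_
    rw [ENNReal.toReal_ofReal (by positivity)]
    simpa using hV.integrable
  have hm2 : MemLp (fun x => fn N a x ^ 2) (ENNReal.ofReal (twoStar N / 2)) volume := by
    refine (integrable_norm_rpow_iff ((measurable_fn a).pow_const 2).aestronglyMeasurable
      (by simp; linarith) ENNReal.ofReal_ne_top).1 ?_
    rw [ENNReal.toReal_ofReal (by linarith)]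
    simp only [Real.norm_eq_abs, hsq]
    exact integrable_abs_fn_rpow a
  have h := integral_mul_le_Lp_mul_Lq_of_nonneg hpq (μ := volume)
    (Eventually.of_forall fun x => abs_nonneg (V x))
    (Eventually.of_forall fun x => sq_nonneg (fn N a x)) hm1 hm2
  refine h.trans_eq ?_
  have e1 : ∫ x, (fn N a x ^ 2) ^ (twoStar N / 2) = ‖fn N a‖ ^ twoStar N := by
    rw [← integral_abs_fn_rpow]
    refine integral_congr_ae (Eventually.of_forall fun x => ?_)
    simp only [← hsq, abs_of_nonneg (sq_nonneg (fn N a x))]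
  rw [e1, ← Real.rpow_mul (norm_nonneg _), one_div_div, one_div_div,
    mul_div_cancel₀ _ (by linarith), ← Real.rpow_natCast _ 2]
  norm_num

lemma sobolevConst_mul_norm_fn_sq_le (a : D12 N) : sobolevConst N * ‖fn N a‖ ^ 2 ≤ ‖a‖ ^ 2 := by
  have h := sobolevConst_mul_le (fn N a) (memD12_of_ae_eq EventuallyEq.rfl)
  rwa [normD_of_ae_eq EventuallyEq.rfl, ← Lp.norm_def] at h

/-- The quadratic form `‖·‖_V²` is nonnegative: this is where the smallness of `V⁻` enters. -/
lemma norm_sq_add_potential_nonneg {V : RN N → ℝ} (hV : PotentialAssumption V) (a : D12 N) :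
    0 ≤ ‖a‖ ^ 2 + ∫ x, V x * fn N a x * fn N a x := by
  have hN' : (3 : ℝ) ≤ N := by exact_mod_cast hN.out
  have hVi := hV.isHalfIntegrable
  have hW : IsHalfIntegrable (fun x => min 0 (V x)) := by
    refine ⟨aestronglyMeasurable_const.inf hVi.aestronglyMeasurable, hVi.integrable.mono'
      ((aestronglyMeasurable_const.inf hVi.aestronglyMeasurable).norm.aemeasurable.pow_const
        _).aestronglyMeasurable (Eventually.of_forall fun x => ?_)⟩
    rw [Real.norm_eq_abs, abs_of_nonneg (by positivity)]
    gcongr 1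
    · rcases le_total 0 (V x) with h | h
      · simp [h]
      · simp [h]
  have h1 := integral_abs_potential_le hW a
  have h2 : (∫ x, |min 0 (V x)| ^ ((N : ℝ) / 2)) ^ (2 / (N : ℝ)) ≤ sobolevConst N := by
    have h3 : 0 ≤ ∫ x, |min 0 (V x)| ^ ((N : ℝ) / 2) := integral_nonneg fun x => by positivity
    calc (∫ x, |min 0 (V x)| ^ ((N : ℝ) / 2)) ^ (2 / (N : ℝ))
        ≤ (sobolevConst N ^ ((N : ℝ) / 2)) ^ (2 / (N : ℝ)) := by
          have := hV.neg_part_small.le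
          gcongr
      _ = sobolevConst N := by
          rw [← Real.rpow_mul hS.out.le]
          have : (N : ℝ) / 2 * (2 / N) = 1 := by field_simp
          rw [this, Real.rpow_one]
  have h4 : -∫ x, |min 0 (V x)| * fn N a x ^ 2 ≤ ∫ x, V x * fn N a x * fn N a x := by
    rw [← integral_neg]
    refine integral_mono ?_ (integrable_potential hVi a a) fun x => ?_
    · refine Integrable.neg ((integrable_potential hW a a).abs.congr
        (Eventually.of_forall fun x => ?_))
      simp only [abs_mul, mul_assoc, sq, abs_mul_abs_self]
    · have h5 : -|min 0 (V x)| ≤ V x := by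
        rw [abs_of_nonpos (min_le_left _ _), neg_neg]
        exact min_le_right _ _
      have := mul_le_mul_of_nonneg_right h5 (sq_nonneg (fn N a x))
      simp only
      linarith [this]
  have h6 := sobolevConst_mul_norm_fn_sq_le a
  have h7 := mul_le_mul_of_nonneg_right h2 (sq_nonneg ‖fn N a‖)
  linarith

/-! ### The nonlinear term -/

variable {f : ℝ → ℝ}

lemma integrable_primitive_fn (hf : GrowthAssumption N f) (a : D12 N) :
    Integrable (fun x => primitive f (fn N a x)) volume := by
  obtain ⟨A, -, -, hA⟩ := hf.exists_critical_bound hN.out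
  exact ((integrable_abs_fn_rpow a).const_mul A).mono'
    (hf.continuous_primitive.measurable.comp (measurable_fn a)).aestronglyMeasurable
    (Eventually.of_forall fun x => hA _)

omit hS in
lemma exists_abs_mul_le (hf : GrowthAssumption N f) {η : ℝ} (hη : 0 < η) :
    ∃ C : ℝ, 0 ≤ C ∧ ∀ s t : ℝ, |f s * t| ≤ η * |s| ^ twoStar N + C * |t| ^ twoStar N := by
  obtain ⟨A, hA, hfA, -⟩ := hf.exists_critical_bound hN.out
  obtain ⟨C, hC, h⟩ := rpow_sub_one_mul_le (q := twoStar N)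
    (by linarith [two_lt_twoStar hN.out]) (η := η / A) (by positivity)
  refine ⟨A * C, by positivity, fun s t => ?_⟩
  rw [abs_mul]
  calc |f s| * |t| ≤ A * (|s| ^ (twoStar N - 1) * |t|) := by
        rw [← mul_assoc]; gcongr; exact hfA s
    _ ≤ A * (η / A * |s| ^ twoStar N + C * |t| ^ twoStar N) := by
        gcongr; exact h _ _ (abs_nonneg s) (abs_nonneg t)
    _ = _ := by field_simp

lemma integrable_f_mul (hf : GrowthAssumption N f) (a b : D12 N) :
    Integrable (fun x => f (fn N a x) * fn N b x) volume := by
  obtain ⟨C, -, hC⟩ := exists_abs_mul_le hf one_pos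
  exact (((integrable_abs_fn_rpow a).const_mul 1).add ((integrable_abs_fn_rpow b).const_mul C)).mono'
    ((hf.contDiff.continuous.measurable.comp (measurable_fn a)).mul
      (measurable_fn b)).aestronglyMeasurable (Eventually.of_forall fun x => hC _ _)

/-- `a ↦ f(a)` is weakly continuous. -/
lemma tendsto_integral_f_mul (hf : GrowthAssumption N f) {a : ℕ → D12 N} {b : D12 N} {M : ℝ}
    (hM : ∀ k, ‖a k‖ ≤ M) (ha : WeakTo a b) (v : D12 N) :
    Tendsto (fun k => ∫ x, f (fn N (a k) x) * fn N v x) atTop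
      (𝓝 (∫ x, f (fn N b x) * fn N v x)) := by
  have hab : WeakTo (fun k => a k - b) 0 := by
    simpa using ha.sub (weakTo_const b)
  refine hab.tendsto_of_ae (M := M + ‖b‖)
    (fun k => (norm_sub_le _ _).trans (by linarith [hM k])) fun σ hσ => ?_
  have hlim : ∀ᵐ x, Tendsto (fun k => fn N (a (σ k)) x) atTop (𝓝 (fn N b x)) := by
    have hall : ∀ᵐ x, ∀ k, fn N (a (σ k)) x = fn N (a (σ k) - b) x + fn N b x := by
      refine ae_all_iff.2 fun k => ?_
      have := fn_add (a (σ k) - b) b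
      rwa [sub_add_cancel] at this
    filter_upwards [hσ, hall] with x hx hx'
    simp only [hx']
    simpa using hx.add_const (fn N b x)
  have hmain := tendsto_integral_abs_of_dominated (μ := volume)
    (h := fun k x => f (fn N (a (σ k)) x) * fn N v x - f (fn N b x) * fn N v x)
    (B := fun k x => |fn N (a (σ k)) x| ^ twoStar N) (M := (embConst N * M) ^ twoStar N)
    (fun k => ((integrable_f_mul hf _ v).sub (integrable_f_mul hf b v)).1)
    (fun k => integrable_abs_fn_rpow _) (fun k x => by positivity)
    (fun k => integral_abs_fn_rpow_le (hM _)) (fun η hη => ?_) ?_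
  · rw [tendsto_iff_norm_sub_tendsto_zero]
    refine squeeze_zero (fun k => norm_nonneg _) (fun k => ?_) hmain
    rw [← integral_sub (integrable_f_mul hf _ v) (integrable_f_mul hf b v)]
    exact norm_integral_le_integral_norm _
  · obtain ⟨C, -, hC⟩ := exists_abs_mul_le hf hη
    refine ⟨fun x => C * |fn N v x| ^ twoStar N + |f (fn N b x) * fn N v x|,
      ((integrable_abs_fn_rpow v).const_mul C).add (integrable_f_mul hf b v).abs, fun k x => ?_⟩
    refine (abs_sub _ _).trans ?_
    linarith [hC (fn N (a (σ k)) x) (fn N v x)]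
  · filter_upwards [hlim] with x hx
    have h1 := ((hf.contDiff.continuous.tendsto _).comp hx).mul_const (fn N v x)
    simpa using h1.sub_const (f (fn N b x) * fn N v x)

/-- **Brezis-Lieb lemma** for the potential energy. -/
lemma tendsto_integral_primitive_add (hf : GrowthAssumption N f) {a : ℕ → D12 N} {M : ℝ}
    (hM : ∀ k, ‖a k‖ ≤ M) (ha : WeakTo a 0) (b : D12 N) :
    Tendsto (fun k => (∫ x, primitive f (fn N (a k + b) x)) - ∫ x, primitive f (fn N (a k) x)) atTop
      (𝓝 (∫ x, primitive f (fn N b x))) := by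
  refine ha.tendsto_of_ae hM fun σ hσ => ?_
  have hi := fun c : D12 N => integrable_primitive_fn hf c
  have hadd : ∀ k, ∫ x, primitive f (fn N (a (σ k) + b) x) =
      ∫ x, primitive f (fn N (a (σ k)) x + fn N b x) := fun k =>
    integral_congr_ae (by filter_upwards [fn_add (a (σ k)) b] with x hx; rw [hx])
  have hi' : ∀ k, Integrable (fun x => primitive f (fn N (a (σ k)) x + fn N b x)) volume := fun k =>
    (hi (a (σ k) + b)).congr (by filter_upwards [fn_add (a (σ k)) b] with x hx; rw [hx])
  have hmain := tendsto_integral_abs_of_dominated (μ := volume)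
    (h := fun k x => primitive f (fn N (a (σ k)) x + fn N b x) - primitive f (fn N (a (σ k)) x) -
      primitive f (fn N b x))
    (B := fun k x => |fn N (a (σ k)) x| ^ twoStar N) (M := (embConst N * M) ^ twoStar N)
    (fun k => (((hi' k).sub (hi _)).sub (hi b)).1)
    (fun k => integrable_abs_fn_rpow _) (fun k x => by positivity)
    (fun k => integral_abs_fn_rpow_le (hM _)) (fun η hη => ?_) ?_
  · rw [tendsto_iff_norm_sub_tendsto_zero]
    refine squeeze_zero (fun k => norm_nonneg _) (fun k => ?_) hmain
    have hi2 : Integrable (fun x => primitive f (fn N (a (σ k)) x + fn N b x) -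
        primitive f (fn N (a (σ k)) x)) volume := (hi' k).sub (hi _)
    rw [hadd, ← integral_sub (hi' k) (hi _), ← integral_sub hi2 (hi b)]
    exact norm_integral_le_integral_norm _
  · obtain ⟨C, hC⟩ := hf.abs_primitive_add_sub_le hN.out hη
    refine ⟨fun x => C * |fn N b x| ^ twoStar N + |primitive f (fn N b x)|,
      ((integrable_abs_fn_rpow b).const_mul C).add (hi b).abs, fun k x => ?_⟩
    refine (abs_sub _ _).trans ?_
    linarith [hC (fn N (a (σ k)) x) (fn N b x)]
  · filter_upwards [hσ] with x hx
    have h1 := (hf.continuous_primitive.tendsto _).comp (hx.add_const (fn N b x))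
    have h2 := (hf.continuous_primitive.tendsto _).comp hx
    have h3 := (h1.sub h2).sub_const (primitive f (fn N b x))
    simpa [primitive] using h3

/-- The nonlinear term vanishes on a sequence that tends to zero in measure. -/
lemma tendsto_integral_f_mul_zero (hf : GrowthAssumption N f) {a r : ℕ → D12 N} {M M' : ℝ}
    (hM : ∀ k, ‖a k‖ ≤ M) (hM' : ∀ k, ‖r k‖ ≤ M')
    (hr : TendstoInMeasure volume (fun k => (fn N (r k) : RN N → ℝ)) atTop 0) :
    Tendsto (fun k => ∫ x, f (fn N (a k) x) * fn N (r k) x) atTop (𝓝 0) := by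
  set B := (embConst N * M) ^ twoStar N + (embConst N * M') ^ twoStar N with hB
  have hM0 : 0 ≤ M := (norm_nonneg _).trans (hM 0)
  have hM0' : 0 ≤ M' := (norm_nonneg _).trans (hM' 0)
  have hemb := embConst_pos (N := N)
  have hB0 : 0 ≤ B := by positivity
  rw [Metric.tendsto_nhds]
  intro ε hε
  set η : ℝ := ε / (2 * (B + 1)) with hη
  obtain ⟨δ, C, hδ, hC, hpt⟩ := hf.abs_mul_le_of_vanishing hN.out (show 0 < η by positivity)
  rw [tendstoInMeasure_iff_norm] at hr
  have hmeas := hr δ hδ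
  simp only [Pi.zero_apply, sub_zero, Real.norm_eq_abs] at hmeas
  have hsmall : 0 < ENNReal.ofReal (ε / (2 * (C + 1))) := by
    rw [ENNReal.ofReal_pos]; positivity
  filter_upwards [hmeas.eventually_lt_const hsmall] with k hk
  rw [Real.dist_eq, sub_zero]
  set s : Set (RN N) := {x | δ ≤ |fn N (r k) x|} with hs
  have hsm : MeasurableSet s := measurableSet_le measurable_const (measurable_fn _).abs
  have hsfin : volume s ≠ ⊤ := (hk.trans ENNReal.ofReal_lt_top).ne
  have hind : Integrable (s.indicator fun _ => C) volume :=
    (integrable_indicator_iff hsm).2 (integrableOn_const hsfin)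
  have hia := integrable_abs_fn_rpow (a k)
  have hir := integrable_abs_fn_rpow (r k)
  have hvol : volume.real s ≤ ε / (2 * (C + 1)) := ENNReal.toReal_le_of_le_ofReal (by positivity) hk.le
  calc |∫ x, f (fn N (a k) x) * fn N (r k) x|
      ≤ ∫ x, |f (fn N (a k) x) * fn N (r k) x| := abs_integral_le_integral_abs
    _ ≤ ∫ x, (η * (|fn N (a k) x| ^ twoStar N + |fn N (r k) x| ^ twoStar N) +
          s.indicator (fun _ => C) x) := by
        refine integral_mono (integrable_f_mul hf _ _).abs (((hia.add hir).const_mul η).add hind)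
          fun x => ?_
        refine (hpt _ _).trans (le_of_eq ?_)
        simp only [Set.indicator_apply, hs, Set.mem_ofPred_eq]
    _ = η * ((∫ x, |fn N (a k) x| ^ twoStar N) + ∫ x, |fn N (r k) x| ^ twoStar N) +
          volume.real s * C := by
        have hi2 : Integrable (fun x =>
            η * (|fn N (a k) x| ^ twoStar N + |fn N (r k) x| ^ twoStar N)) volume :=
          (hia.add hir).const_mul η
        rw [integral_add hi2 hind, integral_const_mul, integral_add hia hir,
          integral_indicator hsm, setIntegral_const, smul_eq_mul]
    _ ≤ η * B + ε / (2 * (C + 1)) * C := by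
        have h1 := integral_abs_fn_rpow_le (hM k)
        have h2 := integral_abs_fn_rpow_le (hM' k)
        gcongr
        exact add_le_add h1 h2
    _ < η * (B + 1) + ε / (2 * (C + 1)) * (C + 1) := by
        have h1 : 0 < η := by positivity
        gcongr <;> linarith
    _ = ε := by rw [hη]; field_simp; ring

/-- The derivative of the nonlinear part of the energy along a line. -/
lemma hasDerivAt_integral_primitive (hf : GrowthAssumption N f) (a b : D12 N) :
    HasDerivAt (fun t : ℝ => ∫ x, primitive f (fn N (a + t • b) x))
      (∫ x, f (fn N a x) * fn N b x) 0 := by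
  obtain ⟨A, hA, hfA, -⟩ := hf.exists_critical_bound hN.out
  have h2 := two_lt_twoStar hN.out
  have hrep : ∀ t : ℝ, (fun x => primitive f (fn N (a + t • b) x)) =ᵐ[volume]
      fun x => primitive f (fn N a x + t * fn N b x) := fun t => by
    filter_upwards [fn_add a (t • b), fn_smul t b] with x h3 h4
    rw [h3, h4]
  have heq : (fun t : ℝ => ∫ x, primitive f (fn N (a + t • b) x)) =
      fun t => ∫ x, primitive f (fn N a x + t * fn N b x) :=
    funext fun t => integral_congr_ae (hrep t)
  rw [heq]
  have h := (hasDerivAt_integral_of_dominated_loc_of_deriv_le (μ := volume) (𝕜 := ℝ)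
    (F := fun t x => primitive f (fn N a x + t * fn N b x))
    (F' := fun t x => f (fn N a x + t * fn N b x) * fn N b x) (x₀ := 0)
    (s := Metric.ball 0 1)
    (bound := fun x => A * (2 ^ twoStar N * (|fn N a x| ^ twoStar N + |fn N b x| ^ twoStar N)))
    (Metric.ball_mem_nhds 0 one_pos)
    (Eventually.of_forall fun t => ((integrable_primitive_fn hf (a + t • b)).congr (hrep t)).1)
    ((integrable_primitive_fn hf (a + (0 : ℝ) • b)).congr (hrep 0)) ?_
    (Eventually.of_forall fun x t ht => ?_)
    ((((integrable_abs_fn_rpow a).add (integrable_abs_fn_rpow b)).const_mul _).const_mul A)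
    (Eventually.of_forall fun x t ht => ?_)).2
  · simpa using h
  · simpa using (integrable_f_mul hf a b).1
  · have ht1 : |t| ≤ 1 := by simpa using (mem_ball_zero_iff.1 ht).le
    have hle : |fn N a x + t * fn N b x| ≤ |fn N a x| + |fn N b x| := by
      refine (abs_add_le _ _).trans ?_
      rw [abs_mul]
      gcongr
      exact mul_le_of_le_one_left (abs_nonneg _) ht1
    rw [Real.norm_eq_abs, abs_mul]
    calc |f (fn N a x + t * fn N b x)| * |fn N b x|
        ≤ (A * (|fn N a x| + |fn N b x|) ^ (twoStar N - 1)) * (|fn N a x| + |fn N b x|) := by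
          have : 0 ≤ twoStar N - 1 := by linarith
          gcongr
          · exact (hfA _).trans (by gcongr)
          · exact le_add_of_nonneg_left (abs_nonneg _)
      _ = A * (|fn N a x| + |fn N b x|) ^ twoStar N := by
          rw [mul_assoc, rpow_sub_one_mul_self (by linarith) (by positivity)]
      _ ≤ _ := by
          gcongr
          exact add_rpow_le (by linarith) (abs_nonneg _) (abs_nonneg _)
  · have h1 : HasDerivAt (fun t : ℝ => fn N a x + t * fn N b x) (fn N b x) t := by
      simpa using ((hasDerivAt_id t).mul_const (fn N b x)).const_add (fn N a x)
    exact (hf.hasDerivAt_primitive _).comp t h1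

end Integrals

/-! ### The energy on the Hilbert space -/

lemma hasDerivAt_quadratic {E : Type*} [AddCommGroup E] [Module ℝ E] (B : LinearMap.BilinForm ℝ E)
    (hB : ∀ a b, B a b = B b a) (a b : E) :
    HasDerivAt (fun t : ℝ => (1 / 2) * B (a + t • b) (a + t • b)) (B a b) 0 := by
  have e : (fun t : ℝ => (1 / 2) * B (a + t • b) (a + t • b)) = fun t =>
      (1 / 2) * B a a + t * B a b + t ^ 2 * ((1 / 2) * B b b) := by
    funext t
    simp only [map_add, map_smul, LinearMap.add_apply, LinearMap.smul_apply, smul_eq_mul, hB b a]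
    ring
  rw [e]
  have h1 := (((hasDerivAt_id (0 : ℝ)).mul_const (B a b)).const_add ((1 / 2) * B a a)).add
    (((hasDerivAt_id (0 : ℝ)).pow 2).mul_const ((1 / 2) * B b b))
  refine HasDerivAt.congr_deriv h1 ?_
  simp

section Energy

variable {N : ℕ} [hN : Fact (3 ≤ N)] [hS : Fact (0 < sobolevConst N)]

/-- The bilinear form `(a, b) ↦ ∫ V a b` on `D^{1,2}`. -/
def potForm {V : RN N → ℝ} (hV : IsHalfIntegrable V) : LinearMap.BilinForm ℝ (D12 N) :=
  LinearMap.mk₂ ℝ (fun a b => ∫ x, V x * fn N a x * fn N b x)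
    (fun a a' b => by
      rw [← integral_add (integrable_potential hV a b) (integrable_potential hV a' b)]
      refine integral_congr_ae ?_
      filter_upwards [fn_add a a'] with x hx
      rw [hx]; ring)
    (fun c a b => by
      rw [smul_eq_mul, ← integral_const_mul]
      refine integral_congr_ae ?_
      filter_upwards [fn_smul c a] with x hx
      rw [hx]; ring)
    (fun a b b' => by
      rw [← integral_add (integrable_potential hV a b) (integrable_potential hV a b')]
      refine integral_congr_ae ?_
      filter_upwards [fn_add b b'] with x hx
      rw [hx]; ring)
    (fun c a b => by
      rw [smul_eq_mul, ← integral_const_mul]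
      refine integral_congr_ae ?_
      filter_upwards [fn_smul c b] with x hx
      rw [hx]; ring)

lemma potForm_apply {V : RN N → ℝ} (hV : IsHalfIntegrable V) (a b : D12 N) :
    potForm hV a b = ∫ x, V x * fn N a x * fn N b x := rfl

lemma potForm_comm {V : RN N → ℝ} (hV : IsHalfIntegrable V) (a b : D12 N) :
    potForm hV a b = potForm hV b a := by
  rw [potForm_apply, potForm_apply]
  refine integral_congr_ae (Eventually.of_forall fun x => ?_)
  exact mul_right_comm _ _ _

lemma potForm_zero (a b : D12 N) : potForm (isHalfIntegrable_zero (N := N)) a b = 0 := by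
  simp [potForm_apply]

/-- The scalar product `⟨·, ·⟩_V` on `D^{1,2}`. -/
def formV {V : RN N → ℝ} (hV : IsHalfIntegrable V) : LinearMap.BilinForm ℝ (D12 N) :=
  innerₗ (D12 N) + potForm hV

lemma formV_apply {V : RN N → ℝ} (hV : IsHalfIntegrable V) (a b : D12 N) :
    formV hV a b = inner ℝ a b + potForm hV a b := rfl

lemma formV_comm {V : RN N → ℝ} (hV : IsHalfIntegrable V) (a b : D12 N) :
    formV hV a b = formV hV b a := by
  rw [formV_apply, formV_apply, real_inner_comm, potForm_comm]

lemma innerV_of_ae_eq {V : RN N → ℝ} (hV : IsHalfIntegrable V) {u v : RN N → ℝ} {a b : D12 N}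
    (hu : u =ᵐ[volume] fn N a) (hv : v =ᵐ[volume] fn N b) : innerV V u v = formV hV a b := by
  have h1 : inner ℝ a b = ∫ x, inner ℝ (a.1 x) (b.1 x) := L2.inner_def a.1 b.1
  rw [formV_apply, h1, potForm_apply, innerV,
    ← integral_add (L2.integrable_inner a.1 b.1) (integrable_potential hV a b)]
  refine integral_congr_ae ?_
  filter_upwards [hu, hv, weakGrad_of_ae_eq hu, weakGrad_of_ae_eq hv] with x h1 h2 h3 h4
  rw [h1, h2, h3, h4]

omit hN hS in
lemma integral_norm_sq_add (V u : RN N → ℝ) :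
    ∫ x, (‖weakGrad u x‖ ^ 2 + V x * u x ^ 2) = innerV V u u := by
  refine integral_congr_ae (Eventually.of_forall fun x => ?_)
  simp only [real_inner_self_eq_norm_sq, sq, mul_assoc]

lemma normV_of_ae_eq {V : RN N → ℝ} (hV : IsHalfIntegrable V) {u : RN N → ℝ} {a : D12 N}
    (hu : u =ᵐ[volume] fn N a) : normV V u = Real.sqrt (formV hV a a) := by
  rw [normV, integral_norm_sq_add, innerV_of_ae_eq hV hu hu]

/-- The energy `I_V` on the Hilbert space. -/
def energyH {V : RN N → ℝ} (hV : IsHalfIntegrable V) (f : ℝ → ℝ) (a : D12 N) : ℝ :=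
  (1 / 2) * formV hV a a - ∫ x, primitive f (fn N a x)

lemma energy_of_ae_eq {V : RN N → ℝ} (hV : IsHalfIntegrable V) (f : ℝ → ℝ) {u : RN N → ℝ}
    {a : D12 N} (hu : u =ᵐ[volume] fn N a) : energy V f u = energyH hV f a := by
  rw [energy, energyH, integral_norm_sq_add, innerV_of_ae_eq hV hu hu]
  congr 1
  refine integral_congr_ae ?_
  filter_upwards [hu] with x hx
  rw [hx]

lemma isSolution_fn {V : RN N → ℝ} (hV : IsHalfIntegrable V) {f : ℝ → ℝ} {a : D12 N}
    (h : ∀ b, formV hV a b = ∫ x, f (fn N a x) * fn N b x) : IsSolution V f (fn N a) := by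
  refine ⟨memD12_of_ae_eq EventuallyEq.rfl, fun v hv => ?_⟩
  obtain ⟨b, hb⟩ := hv.exists_rep
  rw [innerV_of_ae_eq hV EventuallyEq.rfl hb, h b]
  refine integral_congr_ae ?_
  filter_upwards [hb] with x hx
  rw [hx]

lemma formV_sq_le {V : RN N → ℝ} (hV : PotentialAssumption V) (a b : D12 N) :
    formV hV.isHalfIntegrable a b ^ 2 ≤
      formV hV.isHalfIntegrable a a * formV hV.isHalfIntegrable b b := by
  refine LinearMap.BilinForm.apply_sq_le_of_symm _ (fun c => ?_) ⟨fun c d => ?_⟩ a b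
  · rw [formV_apply, real_inner_self_eq_norm_sq]
    exact norm_sq_add_potential_nonneg hV c
  · exact formV_comm _ _ _

lemma exists_formV_self_le {V : RN N → ℝ} (hV : IsHalfIntegrable V) :
    ∃ C : ℝ, 0 ≤ C ∧ ∀ a : D12 N, formV hV a a ≤ C ^ 2 * ‖a‖ ^ 2 := by
  set L := (∫ x, |V x| ^ ((N : ℝ) / 2)) ^ (2 / (N : ℝ)) with hL
  have hL0 : 0 ≤ L := Real.rpow_nonneg (integral_nonneg fun x => by positivity) _
  refine ⟨Real.sqrt (1 + L * embConst N ^ 2), Real.sqrt_nonneg _, fun a => ?_⟩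
  rw [Real.sq_sqrt (by positivity), formV_apply, real_inner_self_eq_norm_sq, potForm_apply]
  have h1 : ∫ x, V x * fn N a x * fn N a x ≤ ∫ x, |V x| * fn N a x ^ 2 := by
    have hi := integrable_potential hV a a
    refine integral_mono hi (hi.abs.congr (Eventually.of_forall fun x => ?_)) fun x => ?_
    · simp only [abs_mul, mul_assoc, sq, abs_mul_abs_self]
    · simp only [mul_assoc, ← sq]
      exact mul_le_mul_of_nonneg_right (le_abs_self _) (sq_nonneg _)
  have h2 := integral_abs_potential_le hV a
  have h3 : L * ‖fn N a‖ ^ 2 ≤ L * (embConst N * ‖a‖) ^ 2 := by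
    have := norm_fn_le a
    gcongr
  have h4 : (1 + L * embConst N ^ 2) * ‖a‖ ^ 2 = ‖a‖ ^ 2 + L * (embConst N * ‖a‖) ^ 2 := by ring
  linarith

variable {f : ℝ → ℝ}

/-- The gradient of the energy represents its derivative along lines. -/
lemma formV_gradient {V : RN N → ℝ} (hV : IsHalfIntegrable V) (hf : GrowthAssumption N f)
    {u g : RN N → ℝ} {a c : D12 N} (hu : u =ᵐ[volume] fn N a) (hg : g =ᵐ[volume] fn N c)
    (h : IsEnergyGradient V f u g) (b : D12 N) :
    formV hV c b = formV hV a b - ∫ x, f (fn N a x) * fn N b x := by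
  have hquad : HasDerivAt (fun t : ℝ => (1 / 2) * formV hV (a + t • b) (a + t • b))
      (formV hV a b) 0 := hasDerivAt_quadratic (formV hV) (formV_comm hV) a b
  have hder : HasDerivAt (fun t : ℝ => energyH hV f (a + t • b))
      (formV hV a b - ∫ x, f (fn N a x) * fn N b x) 0 :=
    hquad.sub (hasDerivAt_integral_primitive hf a b)
  refine HasDerivAt.unique ?_ hder
  rw [hasDerivAt_iff_isLittleO, Asymptotics.isLittleO_iff]
  intro ε hε
  obtain ⟨δ, hδ, hle⟩ := h.2 (ε / (‖b‖ + 1)) (by positivity)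
  filter_upwards [Metric.ball_mem_nhds (0 : ℝ) (show 0 < δ / (‖b‖ + 1) by positivity)] with t ht
  rw [mem_ball_zero_iff, Real.norm_eq_abs, lt_div_iff₀ (by positivity)] at ht
  have hn : normD (fn N (t • b)) = |t| * ‖b‖ := by
    rw [normD_of_ae_eq EventuallyEq.rfl, norm_smul, Real.norm_eq_abs]
  have h1 := hle (fn N (t • b)) (memD12_of_ae_eq EventuallyEq.rfl) (by
    rw [hn]
    refine lt_of_le_of_lt ?_ ht
    gcongr
    linarith)
  have hsum : u + (fn N (t • b) : RN N → ℝ) =ᵐ[volume] fn N (a + t • b) := by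
    filter_upwards [hu, fn_add a (t • b)] with x h2 h3
    rw [Pi.add_apply, h2, h3]
  rw [energy_of_ae_eq hV f hsum, energy_of_ae_eq hV f hu, innerV_of_ae_eq hV hg EventuallyEq.rfl,
    hn, map_smul, smul_eq_mul] at h1
  simp only [zero_smul, add_zero, sub_zero, smul_eq_mul, Real.norm_eq_abs]
  refine h1.trans ?_
  calc ε / (‖b‖ + 1) * (|t| * ‖b‖) ≤ ε / (‖b‖ + 1) * (|t| * (‖b‖ + 1)) := by gcongr; linarith
    _ = ε * |t| := by field_simp

/-- A Palais-Smale sequence on the Hilbert space: along `U` the derivative of the energy tends to zero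
in the dual norm. -/
def IsAlmostCritical {V : RN N → ℝ} (hV : IsHalfIntegrable V) (f : ℝ → ℝ) (U : ℕ → D12 N) : Prop :=
  ∃ ε : ℕ → ℝ, Tendsto ε atTop (𝓝 0) ∧
    ∀ k v, |formV hV (U k) v - ∫ x, f (fn N (U k) x) * fn N v x| ≤ ε k * ‖v‖

lemma IsPalaisSmale.exists_rep {V : RN N → ℝ} (hV : PotentialAssumption V)
    (hf : GrowthAssumption N f) {d : ℝ} {u : ℕ → RN N → ℝ} (hu : IsPalaisSmale V f d u) :
    ∃ U : ℕ → D12 N, (∀ k, u k =ᵐ[volume] fn N (U k)) ∧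
      IsAlmostCritical hV.isHalfIntegrable f U := by
  obtain ⟨hmem, -, g, hg, hlim⟩ := hu
  choose U hU using fun k => (hmem k).exists_rep
  choose G hG using fun k => (hg k).1.exists_rep
  obtain ⟨C, hC, hle⟩ := exists_formV_self_le hV.isHalfIntegrable
  refine ⟨U, hU, fun k => normV V (g k) * C, by simpa using hlim.mul_const C, fun k v => ?_⟩
  simp only [← formV_gradient hV.isHalfIntegrable hf (hU k) (hG k) (hg k) v,
    normV_of_ae_eq hV.isHalfIntegrable (hG k)]
  refine abs_le_of_sq_le_sq ?_ (by positivity)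
  have h0 : 0 ≤ formV hV.isHalfIntegrable (G k) (G k) := by
    rw [formV_apply, real_inner_self_eq_norm_sq]
    exact norm_sq_add_potential_nonneg hV _
  calc formV hV.isHalfIntegrable (G k) v ^ 2
      ≤ formV hV.isHalfIntegrable (G k) (G k) * formV hV.isHalfIntegrable v v := formV_sq_le hV _ _
    _ ≤ formV hV.isHalfIntegrable (G k) (G k) * (C ^ 2 * ‖v‖ ^ 2) := by gcongr; exact hle v
    _ = _ := by rw [mul_pow, mul_pow, Real.sq_sqrt h0, mul_assoc]

lemma integral_comp_fn_trans (F : ℝ → ℝ) (y : RN N) (a : D12 N) :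
    ∫ x, F (fn N (trans N y a) x) = ∫ x, F (fn N a x) := by
  rw [← integral_sub_right_eq_self (fun x => F (fn N a x)) y]
  refine integral_congr_ae ?_
  filter_upwards [fn_trans y a] with x hx
  rw [hx]

lemma integral_f_mul_trans (f : ℝ → ℝ) (y : RN N) (a v : D12 N) :
    ∫ x, f (fn N a x) * fn N (trans N y v) x = ∫ x, f (fn N (trans N (-y) a) x) * fn N v x := by
  rw [← integral_sub_right_eq_self (fun x => f (fn N (trans N (-y) a) x) * fn N v x) y]
  refine integral_congr_ae ?_
  have h1 := (measurePreserving_translate y).quasiMeasurePreserving.ae (fn_trans (-y) a)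
  filter_upwards [fn_trans y v, h1] with x h2 h3
  rw [h2, h3, sub_neg_eq_add, sub_add_cancel]

namespace IsAlmostCritical

variable {V : RN N → ℝ} {hV : IsHalfIntegrable V} {U : ℕ → D12 N} {M : ℝ}

lemma tendsto_zero (h : IsAlmostCritical hV f U) {σ : ℕ → ℕ} (hσ : Tendsto σ atTop atTop)
    {v : ℕ → D12 N} {M' : ℝ} (hv : ∀ k, ‖v k‖ ≤ M') :
    Tendsto (fun k => formV hV (U (σ k)) (v k) - ∫ x, f (fn N (U (σ k)) x) * fn N (v k) x) atTop
      (𝓝 0) := by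
  obtain ⟨ε, hε, hle⟩ := h
  have h0 : Tendsto (fun k => |ε (σ k)| * M') atTop (𝓝 0) := by
    simpa using ((hε.comp hσ).abs).mul_const M'
  refine squeeze_zero_norm (fun k => ?_) h0
  rw [Real.norm_eq_abs]
  refine (hle (σ k) (v k)).trans ?_
  calc ε (σ k) * ‖v k‖ ≤ |ε (σ k)| * ‖v k‖ := by gcongr; exact le_abs_self _
    _ ≤ _ := by gcongr; exact hv k

/-- Weak limits of a Palais-Smale sequence are solutions. -/
lemma solution_of_weakTo (h : IsAlmostCritical hV f U) (hf : GrowthAssumption N f)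
    (hM : ∀ k, ‖U k‖ ≤ M) {σ : ℕ → ℕ} (hσ : Tendsto σ atTop atTop) {w : D12 N}
    (hw : WeakTo (fun k => U (σ k)) w) (v : D12 N) :
    formV hV w v = ∫ x, f (fn N w x) * fn N v x := by
  have h1 := h.tendsto_zero hσ (v := fun _ => v) (fun _ => le_rfl)
  have hsub : WeakTo (fun k => U (σ k) - w) 0 := by simpa using hw.sub (weakTo_const w)
  have h2 := tendsto_potential_zero hV (a := fun k => U (σ k) - w) (b := fun _ => v)
    (fun k => (norm_sub_le _ _).trans (add_le_add_left (hM (σ k)) _)) (fun _ => le_rfl) hsub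
  replace h2 : Tendsto (fun k => potForm hV (U (σ k) - w) v) atTop (𝓝 0) := h2
  simp only [LinearMap.map_sub₂] at h2
  have h3 : Tendsto (fun k => formV hV (U (σ k)) v) atTop (𝓝 (formV hV w v)) := by
    have := (hw v).add (h2.add_const (potForm hV w v))
    simpa [formV_apply] using this
  have h4 := tendsto_integral_f_mul hf (fun k => hM (σ k)) hw v
  exact sub_eq_zero.1 (tendsto_nhds_unique (h3.sub h4) h1)

/-- Weak limits of a Palais-Smale sequence, seen from centres that tend to infinity, are solutions of
the limit problem: the potential is not seen from there. -/
lemma solution_of_weakTo_trans (h : IsAlmostCritical hV f U) (hf : GrowthAssumption N f)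
    (hM : ∀ k, ‖U k‖ ≤ M) {σ : ℕ → ℕ} (hσ : Tendsto σ atTop atTop) {z : ℕ → RN N}
    (hz : Tendsto (fun k => ‖z k‖) atTop atTop) {w : D12 N}
    (hw : WeakTo (fun k => trans N (-z k) (U (σ k))) w) (v : D12 N) :
    formV isHalfIntegrable_zero w v = ∫ x, f (fn N w x) * fn N v x := by
  have h1 := h.tendsto_zero hσ (v := fun k => trans N (z k) v)
    (fun k => ((trans N (z k)).norm_map v).le)
  have h2 := tendsto_potential_zero hV (a := fun k => trans N (z k) v) (b := fun k => U (σ k))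
    (fun k => ((trans N (z k)).norm_map v).le) (fun k => hM (σ k))
    (isTranslationGroup_trans.weakTo_const hz v)
  replace h2 : Tendsto (fun k => potForm hV (trans N (z k) v) (U (σ k))) atTop (𝓝 0) := h2
  have h4 := tendsto_integral_f_mul hf (a := fun k => trans N (-z k) (U (σ k)))
    (fun k => ((trans N (-z k)).norm_map _).le.trans (hM (σ k))) hw v
  have h5 := ((hw v).add h2).sub h4
  have h6 : ∀ k, formV hV (U (σ k)) (trans N (z k) v) =
      inner ℝ (trans N (-z k) (U (σ k))) v + potForm hV (trans N (z k) v) (U (σ k)) := fun k => by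
    rw [formV_apply, potForm_comm, isTranslationGroup_trans.inner_left (-z k), neg_neg]
  simp only [h6, integral_f_mul_trans] at h1
  have h7 := tendsto_nhds_unique h5 h1
  rw [formV_apply, potForm_zero]
  exact sub_eq_zero.1 h7

end IsAlmostCritical

/-- Nontrivial solutions of the limit problem are bounded away from zero. -/
lemma exists_norm_lower_bound (hf : GrowthAssumption N f) : ∃ c : ℝ, 0 < c ∧ ∀ w : D12 N, w ≠ 0 →
    formV isHalfIntegrable_zero w w = ∫ x, f (fn N w x) * fn N w x → c ≤ ‖w‖ := by
  obtain ⟨C, hC, hle⟩ := exists_abs_mul_le hf one_pos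
  have h2 := two_lt_twoStar hN.out
  have hemb := embConst_pos (N := N)
  set K := (1 + C) * embConst N ^ twoStar N with hK
  have hK0 : 0 < K := by positivity
  refine ⟨(K⁻¹) ^ (twoStar N - 2)⁻¹, by positivity, fun w hw heq => ?_⟩
  have hw0 : 0 < ‖w‖ := norm_pos_iff.2 hw
  rw [formV_apply, potForm_zero, add_zero, real_inner_self_eq_norm_sq] at heq
  have h3 : ‖w‖ ^ 2 ≤ K * ‖w‖ ^ twoStar N := by
    have hi := integrable_abs_fn_rpow w
    calc ‖w‖ ^ 2 ≤ ∫ x, (1 + C) * |fn N w x| ^ twoStar N := by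
          rw [heq]
          refine integral_mono (integrable_f_mul hf w w) (hi.const_mul _) fun x => ?_
          refine (le_abs_self _).trans ((hle _ _).trans (le_of_eq ?_))
          ring
      _ ≤ (1 + C) * (embConst N * ‖w‖) ^ twoStar N := by
          rw [integral_const_mul]
          have := integral_abs_fn_rpow_le (le_refl ‖w‖)
          gcongr
      _ = K * ‖w‖ ^ twoStar N := by rw [Real.mul_rpow hemb.le hw0.le, hK]; ring
  have h4 : ‖w‖ ^ twoStar N = ‖w‖ ^ (twoStar N - 2) * ‖w‖ ^ 2 := by
    rw [← Real.rpow_natCast ‖w‖ 2, ← Real.rpow_add hw0]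
    norm_num
  rw [h4, ← mul_assoc] at h3
  have h5 : 1 ≤ K * ‖w‖ ^ (twoStar N - 2) := by
    by_contra hcon
    push Not at hcon
    nlinarith [sq_pos_of_pos hw0]
  have h6 : K⁻¹ ≤ ‖w‖ ^ (twoStar N - 2) := by
    rwa [inv_le_iff_one_le_mul₀' hK0]
  calc (K⁻¹) ^ (twoStar N - 2)⁻¹ ≤ (‖w‖ ^ (twoStar N - 2)) ^ (twoStar N - 2)⁻¹ := by
        have : 0 ≤ (twoStar N - 2)⁻¹ := inv_nonneg.2 (by linarith)
        gcongr
    _ = ‖w‖ := Real.rpow_rpow_inv hw0.le (by linarith)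

/-! ### The splitting -/

section Splitting

variable {V : RN N → ℝ} {hV : IsHalfIntegrable V} {U : ℕ → D12 N} {M : ℝ} {σ : ℕ → ℕ} {m : ℕ}
  {w : Fin (m + 1) → D12 N} {y : Fin (m + 1) → ℕ → RN N}

lemma IsProfileFamily.weakTo_zero (h : IsProfileFamily (trans N) U σ w y) :
    WeakTo (fun k => U (σ k)) (w 0) := by
  have := h.weakTo 0
  simpa [h.center_zero, isTranslationGroup_trans.zero] using this

/-- A remainder that vanishes along all translations tends to zero in norm: tested against it, the
derivative of the energy leaves only its squared norm. -/
lemma IsAlmostCritical.tendsto_norm_remainder (hU : IsAlmostCritical hV f U)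
    (hf : GrowthAssumption N f) (hM : ∀ k, ‖U k‖ ≤ M) (h : IsProfileFamily (trans N) U σ w y)
    (hvan : ∀ z : ℕ → RN N, WeakTo (fun k => trans N (-z k) (remainder (trans N) U σ w y k)) 0) :
    Tendsto (fun k => ‖remainder (trans N) U σ w y k‖) atTop (𝓝 0) := by
  have hbd : ∀ k, ‖remainder (trans N) U σ w y k‖ ≤ M + ∑ i, ‖w i‖ := norm_remainder_le hM
  have hweak : WeakTo (remainder (trans N) U σ w y) 0 := by
    simpa [isTranslationGroup_trans.zero] using hvan 0
  have h1 := hU.tendsto_zero h.strictMono.tendsto_atTop hbd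
  have h2 := tendsto_potential_zero hV hbd (fun k => hM (σ k)) hweak
  have h3 := tendsto_integral_f_mul_zero hf (fun k => hM (σ k)) hbd
    (tendstoInMeasure_of_forall_translate hbd hvan)
  have h4 := h.tendsto_inner_remainder_sub isTranslationGroup_trans
  have h5 : Tendsto (fun k => ‖remainder (trans N) U σ w y k‖ ^ 2) atTop (𝓝 0) := by
    have := ((h1.sub h4).sub h2).add h3
    simp only [sub_zero, add_zero] at this
    refine this.congr fun k => ?_
    rw [formV_apply, potForm_comm, potForm_apply]
    ring
  have h6 := h5.sqrt
  simpa [Real.sqrt_sq (norm_nonneg _)] using h6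

/-- The potential energy splits: the profiles are added to the remainder one at a time, each in its own
frame, where the Brezis-Lieb lemma applies. -/
lemma IsProfileFamily.tendsto_integral_primitive (hf : GrowthAssumption N f) (hM : ∀ k, ‖U k‖ ≤ M)
    (h : IsProfileFamily (trans N) U σ w y) :
    Tendsto (fun k => (∫ x, primitive f (fn N (U (σ k)) x)) -
      ∫ x, primitive f (fn N (remainder (trans N) U σ w y k) x)) atTop
      (𝓝 (∑ i, ∫ x, primitive f (fn N (w i) x))) := by
  have key : ∀ s : Finset (Fin (m + 1)), Tendsto (fun k =>
      (∫ x, primitive f (fn N (remainder (trans N) U σ w y k + ∑ i ∈ s, trans N (y i k) (w i)) x)) -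
      ∫ x, primitive f (fn N (remainder (trans N) U σ w y k) x)) atTop
      (𝓝 (∑ i ∈ s, ∫ x, primitive f (fn N (w i) x))) := by
    intro s
    induction s using Finset.induction_on with
    | empty => simp
    | insert i s hi ih =>
      rw [Finset.sum_insert hi]
      have ha0 := h.weakTo_remainder_add_sum isTranslationGroup_trans hi
      have hbd := fun k => IsProfileFamily.norm_translate_add_sum_le (T := trans N) (σ := σ) (w := w)
        (y := y) hM s (-y i k) k
      refine ((tendsto_integral_primitive_add hf hbd ha0 (w i)).add ih).congr fun k => ?_
      have e1 := IsProfileFamily.translate_add_sum_insert (y := y) (w := w)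
        isTranslationGroup_trans hi (remainder (trans N) U σ w y k) k
      have e2 := integral_comp_fn_trans (primitive f) (-y i k)
        (remainder (trans N) U σ w y k + ∑ j ∈ s, trans N (y j k) (w j))
      have e3 := (congrArg (fun c : D12 N => ∫ x, primitive f (fn N c x)) e1).trans
        (integral_comp_fn_trans (primitive f) _ _)
      exact (congrArg₂ (· - · + _) e3 e2).trans (sub_add_sub_cancel _ _ _)
  refine (key Finset.univ).congr fun k => ?_
  simp only [remainder, sub_add_cancel]

lemma tendsto_integral_primitive_zero (hf : GrowthAssumption N f) {r : ℕ → D12 N}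
    (hr : Tendsto (fun k => ‖r k‖) atTop (𝓝 0)) :
    Tendsto (fun k => ∫ x, primitive f (fn N (r k) x)) atTop (𝓝 0) := by
  obtain ⟨A, hA, -, hFA⟩ := hf.exists_critical_bound hN.out
  have h2 := two_lt_twoStar hN.out
  have h0 : Tendsto (fun k => A * (embConst N * ‖r k‖) ^ twoStar N) atTop (𝓝 0) := by
    have := ((hr.const_mul (embConst N)).rpow_const (p := twoStar N)
      (Or.inr (by linarith))).const_mul A
    simpa [Real.zero_rpow (show twoStar N ≠ 0 by linarith)] using this
  refine squeeze_zero_norm (fun k => ?_) h0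
  refine (norm_integral_le_integral_norm _).trans ?_
  calc ∫ x, ‖primitive f (fn N (r k) x)‖ ≤ ∫ x, A * |fn N (r k) x| ^ twoStar N :=
        integral_mono (integrable_primitive_fn hf _).norm ((integrable_abs_fn_rpow _).const_mul A)
          fun x => hFA _
    _ ≤ _ := by
        rw [integral_const_mul]
        have := integral_abs_fn_rpow_le (le_refl ‖r k‖)
        gcongr

/-- If the remainder tends to zero in norm, the energies converge to the sum of the energies of the
profiles, where the potential acts only on the profile that stays at the origin. -/
lemma IsProfileFamily.tendsto_energy (hf : GrowthAssumption N f) (hM : ∀ k, ‖U k‖ ≤ M)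
    (h : IsProfileFamily (trans N) U σ w y)
    (hr : Tendsto (fun k => ‖remainder (trans N) U σ w y k‖) atTop (𝓝 0)) :
    Tendsto (fun k => energyH hV f (U (σ k))) atTop
      (𝓝 (energyH hV f (w 0) + ∑ i : Fin m, energyH isHalfIntegrable_zero f (w i.succ))) := by
  have hnorm : Tendsto (fun k => ‖U (σ k)‖ ^ 2) atTop (𝓝 (∑ i, ‖w i‖ ^ 2)) := by
    have := (h.tendsto_norm_sq_sub isTranslationGroup_trans).add (hr.pow 2)
    simpa using this
  have hprim : Tendsto (fun k => ∫ x, primitive f (fn N (U (σ k)) x)) atTop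
      (𝓝 (∑ i, ∫ x, primitive f (fn N (w i) x))) := by
    have := (h.tendsto_integral_primitive hf hM).add (tendsto_integral_primitive_zero hf hr)
    simpa using this
  have hpot : Tendsto (fun k => potForm hV (U (σ k)) (U (σ k))) atTop
      (𝓝 (potForm hV (w 0) (w 0))) := by
    have hsub : WeakTo (fun k => U (σ k) - w 0) 0 := by
      simpa using h.weakTo_zero.sub (weakTo_const (w 0))
    have h2 := tendsto_potential_zero hV (a := fun k => U (σ k) - w 0)
      (b := fun k => U (σ k) + w 0) (M := M + ‖w 0‖) (M' := M + ‖w 0‖)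
      (fun k => (norm_sub_le _ _).trans (add_le_add_left (hM (σ k)) _))
      (fun k => (norm_add_le _ _).trans (add_le_add_left (hM (σ k)) _)) hsub
    have h3 := h2.add_const (potForm hV (w 0) (w 0))
    rw [zero_add] at h3
    refine h3.congr fun k => ?_
    rw [← potForm_apply hV]
    simp only [map_add, map_sub, LinearMap.sub_apply, potForm_comm hV (w 0) (U (σ k))]
    ring
  have hlim := ((hnorm.add hpot).const_mul (1 / 2)).sub hprim
  have e : energyH hV f (w 0) + ∑ i : Fin m, energyH isHalfIntegrable_zero f (w i.succ) =
      1 / 2 * (∑ i, ‖w i‖ ^ 2 + potForm hV (w 0) (w 0)) -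
        ∑ i, ∫ x, primitive f (fn N (w i) x) := by
    simp only [energyH, formV_apply, potForm_zero, real_inner_self_eq_norm_sq, Fin.sum_univ_succ,
      add_zero, Finset.sum_sub_distrib, ← Finset.mul_sum]
    ring
  rw [e]
  refine hlim.congr fun k => ?_
  rw [energyH, formV_apply, real_inner_self_eq_norm_sq]

end Splitting

lemma fn_sum {ι : Type*} (s : Finset ι) (a : ι → D12 N) :
    fn N (∑ i ∈ s, a i) =ᵐ[volume] fun x => ∑ i ∈ s, fn N (a i) x := by
  classical
  induction s using Finset.induction_on with
  | empty =>
    simp only [Finset.sum_empty]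
    exact fn_zero
  | insert i s hi ih =>
    rw [Finset.sum_insert hi]
    filter_upwards [fn_add (a i) (∑ j ∈ s, a j), ih] with x h1 h2
    rw [h1, h2, Finset.sum_insert hi]

end Energy

/-- The smallness assumption on `V⁻` presupposes that `D^{1,2}` embeds into `L^{2*}`. -/
lemma PotentialAssumption.sobolevConst_pos {N : ℕ} (hN : 3 ≤ N) {V : RN N → ℝ}
    (hV : PotentialAssumption V) : 0 < sobolevConst N := by
  have hN' : (3 : ℝ) ≤ N := by exact_mod_cast hN
  have h0 : 0 ≤ sobolevConst N := Real.sInf_nonneg (by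
    rintro t ⟨u, -, -, rfl⟩
    positivity)
  refine h0.lt_of_ne' fun h => ?_
  have h1 := hV.neg_part_small
  rw [h, Real.zero_rpow (by positivity)] at h1
  exact absurd h1 (not_lt.2 (integral_nonneg fun x => by positivity))

end ZeroMass

end

open ZeroMass
theorem lemma3p9 (N : ℕ) (hN : 3 ≤ N) (V : RN N → ℝ) (f : ℝ → ℝ)
    (hV : PotentialAssumption V) (hf₁ : GrowthAssumption N f) (hf₂ : SuperlinearAssumption f)
    (d : ℝ) (u : ℕ → RN N → ℝ) (hu : IsPalaisSmale V f d u)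
    (hbdd : ∃ C : ℝ, ∀ k, normD (u k) ≤ C) :
    ∃ σ : ℕ → ℕ, StrictMono σ ∧
      ∃ u₀ : RN N → ℝ, IsSolution V f u₀ ∧
      ∃ (m : ℕ) (w : Fin m → RN N → ℝ) (y : Fin m → ℕ → RN N),
        (∀ i, IsSolution 0 f (w i) ∧ ¬ (w i =ᵐ[volume] 0)) ∧
        (∀ i, Tendsto (fun k => ‖y i k‖) atTop atTop) ∧
        (∀ i j, i ≠ j → Tendsto (fun k => ‖y j k - y i k‖) atTop atTop) ∧
        Tendsto (fun k => normD (fun x => u (σ k) x - ∑ i, w i (x - y i k) - u₀ x))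
          atTop (𝓝 0) ∧
        d = energy V f u₀ + ∑ i, energy 0 f (w i) := by
  have : Fact (3 ≤ N) := ⟨hN⟩
  have : Fact (0 < sobolevConst N) := ⟨hV.sobolevConst_pos hN⟩
  obtain ⟨M, hM⟩ := hbdd
  obtain ⟨U, hU, hcrit⟩ := hu.exists_rep hV hf₁
  have hUM : ∀ k, ‖U k‖ ≤ M := fun k => by
    rw [← normD_of_ae_eq (hU k)]
    exact hM k
  obtain ⟨c, hc, hlow⟩ := exists_norm_lower_bound hf₁ (N := N)
  obtain ⟨m, σ, w, y, h, hvan⟩ := exists_profileFamily isTranslationGroup_trans hUM hc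
    fun τ z b hτ hz hb hb0 => hlow b hb0
      (hcrit.solution_of_weakTo_trans hf₁ hUM hτ.tendsto_atTop hz hb b)
  have hr := hcrit.tendsto_norm_remainder hf₁ hUM h hvan
  refine ⟨σ, h.strictMono, fn N (w 0), isSolution_fn hV.isHalfIntegrable
      (hcrit.solution_of_weakTo hf₁ hUM h.strictMono.tendsto_atTop h.weakTo_zero), m,
    fun i => fn N (w i.succ), fun i => y i.succ, fun i => ⟨?_, ?_⟩,
    fun i => h.tendsto_norm_center (Fin.succ_ne_zero i),
    fun i j hij => h.separated _ _ fun e => hij (Fin.succ_injective m e), ?_, ?_⟩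
  · exact isSolution_fn isHalfIntegrable_zero (hcrit.solution_of_weakTo_trans hf₁ hUM
      h.strictMono.tendsto_atTop (h.tendsto_norm_center (Fin.succ_ne_zero i)) (h.weakTo _))
  · intro h0
    refine h.ne_zero _ (Fin.succ_ne_zero i) (norm_eq_zero.1 ?_)
    have h1 : (fn N (w i.succ) : RN N → ℝ) =ᵐ[volume] fn N (0 : D12 N) := h0.trans fn_zero.symm
    rw [← normD_of_ae_eq (u := fn N (w i.succ)) EventuallyEq.rfl, normD_of_ae_eq h1, norm_zero]
  · refine hr.congr fun k => (normD_of_ae_eq ?_).symm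
    have hsum := fn_sum Finset.univ fun i => trans N (y i k) (w i)
    have htr : ∀ᵐ x, ∀ i, fn N (trans N (y i k) (w i)) x = fn N (w i) (x - y i k) :=
      ae_all_iff.2 fun i => fn_trans (y i k) (w i)
    have hrem := fn_add (remainder (trans N) U σ w y k) (∑ i, trans N (y i k) (w i))
    have hU' : remainder (trans N) U σ w y k + ∑ i, trans N (y i k) (w i) = U (σ k) :=
      sub_add_cancel _ _
    rw [hU'] at hrem
    filter_upwards [hU (σ k), hsum, htr, hrem] with x h1 h2 h3 h4
    have h5 : fn N (w 0) (x - y 0 k) = fn N (w 0) x := by rw [h.center_zero, Pi.zero_apply, sub_zero]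
    rw [h2, Fin.sum_univ_succ, h3 0, h5] at h4
    simp only [h3] at h4
    rw [h1, h4]
    ring
  · rw [energy_of_ae_eq hV.isHalfIntegrable f EventuallyEq.rfl]
    simp only [energy_of_ae_eq isHalfIntegrable_zero f EventuallyEq.rfl]
    refine tendsto_nhds_unique ?_ (h.tendsto_energy hf₁ hUM hr)
    refine (hu.2.1.comp h.strictMono.tendsto_atTop).congr fun k => ?_
    exact energy_of_ae_eq hV.isHalfIntegrable f (hU (σ k))
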